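/- Let $p\ge 1$, let $\mathbb F\in\{\mathbb R,\mathbb C\}$, let $H$ be an $\mathbb F$-Hilbert space and $T\ge 0$. Let $H^{\otimes n}$ denote the Hilbert space tensor power ($H^{\otimes 0}=\mathbb F$, $\langle x_1\otimes\dots\otimes x_n,\,y_1\otimes\dots\otimes y_n\rangle_n=\prod_i\langle x_i,y_i\rangle_H$, norm $|\cdot|_n$), let $T((H))=\prod_{n\ge 0}H^{\otimes n}$ be the extended tensor algebra with product $(x\otimes y)_n=\sum_{k=0}^n x_k\otimes y_{n-k}$, and let $$\mathcal F(H)=\Big\{x\in T((H)) : \|x\|_{\mathcal F(H)}^2=\sum_{n\ge 0}|x_n|_n^2<\infty\Big\}$$ be the full Fock space. Put $\triangle_T=\{(s,t): 0\le s\le t\le T\}$. For $N\in\mathbb N\cup\{\infty\}$, a multiplicative functional of degree $N$ is a map $\mathbf X=(1,X^1,\dots,X^N)$ on $\triangle_T$ whose levels $X^i:\triangle_T\to H^{\otimes i}$ are continuous and which satisfies $\mathbf X_{s,t}=\mathbf X_{s,u}\otimes\mathbf X_{u,t}$ (up to level $N$) for all $0\le s\le u\le t\le T$. It has finite $p$-variation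 if $V^i_{0,T}<\infty$ for every $1\le i\le N$ (every $i\geq 1$ if $N=\infty$), where $$V^i_{s,t}=\sup_{P}\sum_{t_k\in P}|X^i_{t_k,t_{k+1}}|_i^{p/i},$$ the supremum being over the finite partitions $P$ of $[s,t]$. A $p$-rough path is a multiplicative functional of degree $\lfloor p\rfloor$ with finite $p$-variation, and $\|\mathbf X\|_{p,[s,t]}=\max_{1\le i\le\lfloor p\rfloor}(V^i_{s,t})^{1/p}$. A signature of a $p$-rough path $\mathbf X$ is a multiplicative functional $\mathbf X^{\le\infty}:\triangle_T\to T((H))$ of degree $\infty$ with finite $p$-variation whose levels up to $\lfloor p\rfloor$ are those of $\mathbf X$. Let $E_{\alpha,\beta}(z)=\sum_{n\ge 0}z^n/(\alpha n+\beta)!$ with $x!=\Gamma(x+1)$ be the Mittag-Leffler function. Then every $p$-rough path $\mathbf X$ has exactly one signature $\mathbf X^{\le\infty}$, and $\mathbf X^{\le\infty}_{s,t}\in\mathcal F(H)$ for every $(s,t)\in\triangle_T$. Moreover, there are constants $\beta(p),C(p)>0$ depending only on $p$ such that, for all such $\mathbb F$, $H$, $T$, $\mathbf X$ and all $(s,t)\in\triangle_T$,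 $$\|\mathbf X^{\le\infty}_{s,t}\|_{\mathcal F(H)}\le\sum_{n=0}^\infty|X^n_{s,t}|_n\le\frac{1}{\beta(p)}\,E_{1/p,0}\big(C(p)\,\|\mathbf X\|_{p,[s,t]}\big)<\infty .$$ -/

import Mathlib

open scoped TensorProduct ENNReal

universe u v

/-! ### Hilbert space tensor powers -/

/-- The algebraic tensor power `H ⊗ ⋯ ⊗ H` (`n` factors), as a fresh type, so that it can carry the
Hilbertian inner product rather than the projective seminorm. -/
def AlgTensorPower (𝕜 : Type v) [RCLike 𝕜] (H : Type u) [NormedAddCommGroup H]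
    [InnerProductSpace 𝕜 H] (n : ℕ) : Type (max u v) :=
  ⨂[𝕜]^n H

namespace AlgTensorPower

variable {𝕜 : Type v} [RCLike 𝕜] {H : Type u} [NormedAddCommGroup H] [InnerProductSpace 𝕜 H]

noncomputable instance instAddCommGroup (n : ℕ) : AddCommGroup (AlgTensorPower 𝕜 H n) :=
  inferInstanceAs (AddCommGroup (⨂[𝕜] _ : Fin n, H))

noncomputable instance instModule (n : ℕ) : Module 𝕜 (AlgTensorPower 𝕜 H n) :=
  inferInstanceAs (Module 𝕜 (⨂[𝕜] _ : Fin n, H))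

/-- The pure tensor `x 0 ⊗ ⋯ ⊗ x (n - 1)`. -/
noncomputable def tprod (n : ℕ) : MultilinearMap 𝕜 (fun _ : Fin n => H) (AlgTensorPower 𝕜 H n) :=
  PiTensorProduct.tprod 𝕜

theorem induction_on {n : ℕ} {P : AlgTensorPower 𝕜 H n → Prop} (z : AlgTensorPower 𝕜 H n)
    (smul_tprod : ∀ (r : 𝕜) (x : Fin n → H), P (r • tprod n x))
    (add : ∀ x y, P x → P y → P (x + y)) : P z :=
  PiTensorProduct.induction_on (motive := P) z smul_tprod add

/-- `H^{⊗0}` is the ground field. -/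
noncomputable def zeroEquiv : AlgTensorPower 𝕜 H 0 ≃ₗ[𝕜] 𝕜 :=
  PiTensorProduct.isEmptyEquiv (Fin 0)

/-- `H^{⊗(n+1)} = H^{⊗n} ⊗ H`. -/
noncomputable def succEquiv (n : ℕ) :
    AlgTensorPower 𝕜 H (n + 1) ≃ₗ[𝕜] AlgTensorPower 𝕜 H n ⊗[𝕜] H :=
  LinearEquiv.trans
    (LinearEquiv.symm (TensorPower.mulEquiv : (⨂[𝕜]^n H) ⊗[𝕜] (⨂[𝕜]^1 H) ≃ₗ[𝕜] ⨂[𝕜]^(n + 1) H))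
    (TensorProduct.congr (LinearEquiv.refl 𝕜 (⨂[𝕜]^n H))
      (PiTensorProduct.subsingletonEquiv (R := 𝕜) (s := fun _ : Fin 1 => H) 0))

/-- The tensor product `H^{⊗i} × H^{⊗j} → H^{⊗n}` where `i + j = n`. -/
noncomputable def mul {i j n : ℕ} (h : i + j = n) :
    AlgTensorPower 𝕜 H i →ₗ[𝕜] AlgTensorPower 𝕜 H j →ₗ[𝕜] AlgTensorPower 𝕜 H n :=
  (TensorProduct.mk 𝕜 (⨂[𝕜]^i H) (⨂[𝕜]^j H)).compr₂
    ((TensorPower.mulEquiv (R := 𝕜) (M := H) (n := i) (m := j)).trans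
      (TensorPower.cast 𝕜 H h)).toLinearMap

theorem mul_tprod {i j n : ℕ} (h : i + j = n) (x : Fin i → H) (y : Fin j → H) :
    mul (𝕜 := 𝕜) h (tprod i x) (tprod j y) = tprod n (Fin.append x y ∘ Fin.cast h.symm) := by
  refine (congrArg (TensorPower.cast 𝕜 H h) (TensorPower.tprod_mul_tprod 𝕜 x y)).trans ?_
  exact TensorPower.cast_tprod 𝕜 H h _

theorem succEquiv_tprod (n : ℕ) (x : Fin (n + 1) → H) :
    succEquiv (𝕜 := 𝕜) n (tprod (n + 1) x) =
      tprod (𝕜 := 𝕜) n (fun i => x i.castSucc) ⊗ₜ[𝕜] x (Fin.last n) := by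
  rw [← LinearEquiv.eq_symm_apply]
  have key : (PiTensorProduct.subsingletonEquiv (R := 𝕜) (s := fun _ : Fin 1 => H) (0 : Fin 1)).symm
      (x (Fin.last n)) = PiTensorProduct.tprod 𝕜 (fun _ : Fin 1 => x (Fin.last n)) := by
    rw [LinearEquiv.symm_apply_eq]
    exact (PiTensorProduct.subsingletonEquiv_apply_tprod (R := 𝕜) (0 : Fin 1)
      (fun _ : Fin 1 => x (Fin.last n))).symm
  symm
  refine (congrArg (fun z => TensorPower.mulEquiv (R := 𝕜) (M := H) (n := n) (m := 1)
    (PiTensorProduct.tprod 𝕜 (fun i : Fin n => x i.castSucc) ⊗ₜ[𝕜] z)) key).trans ?_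
  refine (TensorPower.tprod_mul_tprod 𝕜 (fun i : Fin n => x i.castSucc)
    (fun _ : Fin 1 => x (Fin.last n))).trans ?_
  refine congrArg (PiTensorProduct.tprod 𝕜) (funext fun i => ?_)
  refine Fin.lastCases ?_ (fun i => ?_) i
  · exact Fin.append_right (fun i : Fin n => x i.castSucc) (fun _ : Fin 1 => x (Fin.last n)) 0
  · exact Fin.append_left (fun i : Fin n => x i.castSucc) (fun _ : Fin 1 => x (Fin.last n)) i

/-- Transport of an inner product along a linear equivalence. -/
@[reducible]
noncomputable def coreOfEquiv {E F : Type*} [AddCommGroup E] [Module 𝕜 E] [NormedAddCommGroup F]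
    [InnerProductSpace 𝕜 F] (e : E ≃ₗ[𝕜] F) : InnerProductSpace.Core 𝕜 E where
  inner x y := inner 𝕜 (e x) (e y)
  conj_inner_symm x y := inner_conj_symm _ _
  re_inner_nonneg x := by simp
  add_left x y z := by simp [inner_add_left]
  smul_left x y r := by simp [inner_smul_left]
  definite x hx := by simpa using hx

/-- The inner product on the algebraic tensor powers, built with `H^{⊗(n+1)} = H^{⊗n} ⊗ H`;
see `AlgTensorPower.inner_tprod` for its characterization. -/
@[reducible]
noncomputable def core : ∀ n : ℕ, InnerProductSpace.Core 𝕜 (AlgTensorPower 𝕜 H n)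
  | 0 => coreOfEquiv zeroEquiv
  | n + 1 =>
    letI : InnerProductSpace.Core 𝕜 (AlgTensorPower 𝕜 H n) := core n
    letI : NormedAddCommGroup (AlgTensorPower 𝕜 H n) :=
      InnerProductSpace.Core.toNormedAddCommGroup (𝕜 := 𝕜)
    letI : InnerProductSpace 𝕜 (AlgTensorPower 𝕜 H n) := .ofCore _
    coreOfEquiv (succEquiv n)

noncomputable instance instNormedAddCommGroup (n : ℕ) :
    NormedAddCommGroup (AlgTensorPower 𝕜 H n) :=
  (core (𝕜 := 𝕜) (H := H) n).toNormedAddCommGroup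

noncomputable instance instInnerProductSpace (n : ℕ) :
    InnerProductSpace 𝕜 (AlgTensorPower 𝕜 H n) :=
  .ofCore (core (𝕜 := 𝕜) (H := H) n).toCore

theorem inner_zero_eq (x y : AlgTensorPower 𝕜 H 0) :
    inner 𝕜 x y = inner 𝕜 (zeroEquiv x) (zeroEquiv y) := rfl

theorem inner_succ_eq (n : ℕ) (x y : AlgTensorPower 𝕜 H (n + 1)) :
    inner 𝕜 x y = inner 𝕜 (succEquiv n x) (succEquiv n y) := rfl

/-- `⟨x₁ ⊗ ⋯ ⊗ xₙ, y₁ ⊗ ⋯ ⊗ yₙ⟩ = ∏ ⟨xᵢ, yᵢ⟩`. -/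
theorem inner_tprod (n : ℕ) (x y : Fin n → H) :
    inner 𝕜 (tprod (𝕜 := 𝕜) n x) (tprod (𝕜 := 𝕜) n y) = ∏ i, inner 𝕜 (x i) (y i) := by
  induction n with
  | zero =>
    rw [inner_zero_eq]
    have h1 : ∀ z : Fin 0 → H, zeroEquiv (tprod (𝕜 := 𝕜) 0 z) = 1 := fun z =>
      PiTensorProduct.isEmptyEquiv_apply_tprod (R := 𝕜) (Fin 0) z
    simp [h1]
  | succ n ih =>
    rw [inner_succ_eq, succEquiv_tprod, succEquiv_tprod, TensorProduct.inner_tmul, ih,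
      Fin.prod_univ_castSucc]

theorem inner_mul_mul {i j n : ℕ} (h : i + j = n) (x x' : AlgTensorPower 𝕜 H i)
    (y y' : AlgTensorPower 𝕜 H j) :
    inner 𝕜 (mul h x y) (mul h x' y') = inner 𝕜 x x' * inner 𝕜 y y' := by
  induction x using induction_on with
  | add a b ha hb => simp only [map_add, LinearMap.add_apply, inner_add_left, ha, hb, add_mul]
  | smul_tprod r a =>
  induction x' using induction_on with
  | add a b ha hb => simp only [map_add, LinearMap.add_apply, inner_add_right, ha, hb, add_mul]
  | smul_tprod r' a' =>
  induction y using induction_on with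
  | add a b ha hb => simp only [map_add, inner_add_left, ha, hb, mul_add]
  | smul_tprod t b =>
  induction y' using induction_on with
  | add a b ha hb => simp only [map_add, inner_add_right, ha, hb, mul_add]
  | smul_tprod t' b' =>
  subst h
  simp only [map_smul, LinearMap.smul_apply, inner_smul_left, inner_smul_right, mul_tprod,
    inner_tprod, Fin.prod_univ_add, Function.comp_apply, Fin.cast_eq_self, Fin.append_left,
    Fin.append_right]
  ring

theorem norm_mul_apply {i j n : ℕ} (h : i + j = n) (x : AlgTensorPower 𝕜 H i)
    (y : AlgTensorPower 𝕜 H j) : ‖mul h x y‖ = ‖x‖ * ‖y‖ := by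
  have h2 : ‖mul h x y‖ ^ 2 = (‖x‖ * ‖y‖) ^ 2 := by
    have h1 := inner_mul_mul (𝕜 := 𝕜) h x x y y
    rw [inner_self_eq_norm_sq_to_K, inner_self_eq_norm_sq_to_K, inner_self_eq_norm_sq_to_K] at h1
    rw [mul_pow]
    exact_mod_cast h1
  exact (sq_eq_sq₀ (norm_nonneg _) (by positivity)).1 h2

/-- `AlgTensorPower.mul` as a continuous bilinear map. -/
noncomputable def mulL {i j n : ℕ} (h : i + j = n) :
    AlgTensorPower 𝕜 H i →L[𝕜] AlgTensorPower 𝕜 H j →L[𝕜] AlgTensorPower 𝕜 H n :=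
  (mul h).mkContinuous₂ 1 fun x y => by rw [norm_mul_apply, one_mul]

end AlgTensorPower

/-- The Hilbert space tensor power `H^{⊗n}`: the completion of the algebraic tensor power for
`⟨x₁ ⊗ ⋯ ⊗ xₙ, y₁ ⊗ ⋯ ⊗ yₙ⟩ = ∏ ⟨xᵢ, yᵢ⟩`. -/
abbrev HilbertTensorPower (𝕜 : Type v) [RCLike 𝕜] (H : Type u) [NormedAddCommGroup H]
    [InnerProductSpace 𝕜 H] (n : ℕ) : Type (max u v) :=
  UniformSpace.Completion (AlgTensorPower 𝕜 H n)

namespace HilbertTensorPower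

variable {𝕜 : Type v} [RCLike 𝕜] {H : Type u} [NormedAddCommGroup H] [InnerProductSpace 𝕜 H]

/-- The pure tensor `x 0 ⊗ ⋯ ⊗ x (n - 1)`. -/
noncomputable def tprod {n : ℕ} (x : Fin n → H) : HilbertTensorPower 𝕜 H n :=
  ((AlgTensorPower.tprod (𝕜 := 𝕜) n x : AlgTensorPower 𝕜 H n) :
    UniformSpace.Completion (AlgTensorPower 𝕜 H n))

/-- `1 ∈ 𝕜 = H^{⊗0}`, that is, the empty tensor product. -/
noncomputable def one : HilbertTensorPower 𝕜 H 0 := tprod Fin.elim0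

/-- Left multiplication by an algebraic tensor, extended by continuity. -/
noncomputable def mulLeft {i j n : ℕ} (h : i + j = n) (x : AlgTensorPower 𝕜 H i) :
    HilbertTensorPower 𝕜 H j →L[𝕜] HilbertTensorPower 𝕜 H n :=
  ((UniformSpace.Completion.toComplL (𝕜 := 𝕜)).comp
    (AlgTensorPower.mulL h x)).fromCompletion

theorem mulLeft_coe {i j n : ℕ} (h : i + j = n) (x : AlgTensorPower 𝕜 H i)
    (y : AlgTensorPower 𝕜 H j) :
    mulLeft h x (y : HilbertTensorPower 𝕜 H j) =
      ((AlgTensorPower.mul h x y : AlgTensorPower 𝕜 H n) : HilbertTensorPower 𝕜 H n) :=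
  ContinuousLinearMap.fromCompletion_apply_coe _ _

theorem norm_mulLeft_apply {i j n : ℕ} (h : i + j = n) (x : AlgTensorPower 𝕜 H i)
    (y : HilbertTensorPower 𝕜 H j) : ‖mulLeft h x y‖ = ‖x‖ * ‖y‖ := by
  induction y using UniformSpace.Completion.induction_on with
  | hp => exact isClosed_eq (by fun_prop) (by fun_prop)
  | ih y => rw [mulLeft_coe, UniformSpace.Completion.norm_coe, UniformSpace.Completion.norm_coe,
      AlgTensorPower.norm_mul_apply]

theorem mulLeft_add {i j n : ℕ} (h : i + j = n) (x x' : AlgTensorPower 𝕜 H i) :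
    (mulLeft h (x + x') : HilbertTensorPower 𝕜 H j →L[𝕜] HilbertTensorPower 𝕜 H n) =
      mulLeft h x + mulLeft h x' := by
  refine ContinuousLinearMap.ext fun y => ?_
  rw [add_apply]
  induction y using UniformSpace.Completion.induction_on with
  | hp => exact isClosed_eq (by fun_prop) (by fun_prop)
  | ih y => rw [mulLeft_coe, mulLeft_coe, mulLeft_coe, map_add, LinearMap.add_apply,
      UniformSpace.Completion.coe_add]

theorem mulLeft_smul {i j n : ℕ} (h : i + j = n) (c : 𝕜) (x : AlgTensorPower 𝕜 H i) :
    (mulLeft h (c • x) : HilbertTensorPower 𝕜 H j →L[𝕜] HilbertTensorPower 𝕜 H n) =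
      c • mulLeft h x := by
  refine ContinuousLinearMap.ext fun y => ?_
  rw [smul_apply]
  induction y using UniformSpace.Completion.induction_on with
  | hp => exact isClosed_eq (by fun_prop) ((ContinuousLinearMap.continuous _).const_smul c)
  | ih y => rw [mulLeft_coe, mulLeft_coe, map_smul, LinearMap.smul_apply,
      UniformSpace.Completion.coe_smul]

/-- The tensor product `H^{⊗i} × H^{⊗j} → H^{⊗n}`, where `i + j = n`, extended by continuity. -/
noncomputable def mul {i j n : ℕ} (h : i + j = n) :
    HilbertTensorPower 𝕜 H i →L[𝕜] HilbertTensorPower 𝕜 H j →L[𝕜] HilbertTensorPower 𝕜 H n :=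
  (LinearMap.mkContinuous
    { toFun := mulLeft h
      map_add' := mulLeft_add h
      map_smul' := mulLeft_smul h }
    1 fun x => by
      refine ContinuousLinearMap.opNorm_le_bound _ (by positivity) fun y => ?_
      rw [one_mul]
      exact (norm_mulLeft_apply h x y).le).fromCompletion

theorem mul_coe {i j n : ℕ} (h : i + j = n) (x : AlgTensorPower 𝕜 H i)
    (y : AlgTensorPower 𝕜 H j) :
    mul h (x : HilbertTensorPower 𝕜 H i) (y : HilbertTensorPower 𝕜 H j) =
      ((AlgTensorPower.mul h x y : AlgTensorPower 𝕜 H n) : HilbertTensorPower 𝕜 H n) := by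
  rw [mul, ContinuousLinearMap.fromCompletion_apply_coe]
  exact mulLeft_coe h x y

theorem inner_tprod {n : ℕ} (x y : Fin n → H) :
    inner 𝕜 (tprod (𝕜 := 𝕜) x) (tprod (𝕜 := 𝕜) y) = ∏ i, inner 𝕜 (x i) (y i) := by
  rw [tprod, tprod, UniformSpace.Completion.inner_coe, AlgTensorPower.inner_tprod]

theorem mul_tprod {i j n : ℕ} (h : i + j = n) (x : Fin i → H) (y : Fin j → H) :
    mul (𝕜 := 𝕜) h (tprod x) (tprod y) = tprod (Fin.append x y ∘ Fin.cast h.symm) := by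
  rw [tprod, tprod, mul_coe, AlgTensorPower.mul_tprod, tprod]

end HilbertTensorPower

/-! ### Extended tensor algebra and full Fock space -/

/-- The extended tensor algebra `T((H)) = ∏ₙ H^{⊗n}`. -/
abbrev ExtTensorAlgebra (𝕜 : Type v) [RCLike 𝕜] (H : Type u) [NormedAddCommGroup H]
    [InnerProductSpace 𝕜 H] : Type (max u v) :=
  ∀ n : ℕ, HilbertTensorPower 𝕜 H n

/-- The product of `T((H))`: `(x ⊗ y)ₙ = ∑_{k ≤ n} x_k ⊗ y_{n-k}`. -/
noncomputable def ExtTensorAlgebra.mul {𝕜 : Type v} [RCLike 𝕜] {H : Type u}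
    [NormedAddCommGroup H] [InnerProductSpace 𝕜 H] (x y : ExtTensorAlgebra 𝕜 H) :
    ExtTensorAlgebra 𝕜 H := fun n =>
  ∑ k : Fin (n + 1),
    HilbertTensorPower.mul (Nat.add_sub_of_le (Nat.lt_succ_iff.1 k.2)) (x k) (y (n - k))

/-- The full Fock space: the Hilbert space direct sum of the `H^{⊗n}`, that is, all `x ∈ T((H))`
with `∑ₙ ‖xₙ‖² < ∞`, normed by `‖x‖² = ∑ₙ ‖xₙ‖²`. -/
abbrev FockSpace (𝕜 : Type v) [RCLike 𝕜] (H : Type u) [NormedAddCommGroup H]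
    [InnerProductSpace 𝕜 H] : Type (max u v) :=
  lp (fun n : ℕ => HilbertTensorPower 𝕜 H n) 2

/-! ### Rough paths and their signatures -/

/-- The simplex `{(s, t) | 0 ≤ s ≤ t ≤ T}`. -/
def Triangle (T : ℝ) : Set (ℝ × ℝ) := {x | 0 ≤ x.1 ∧ x.1 ≤ x.2 ∧ x.2 ≤ T}

section RoughPath

variable {𝕜 : Type v} [RCLike 𝕜] {H : Type u} [NormedAddCommGroup H] [InnerProductSpace 𝕜 H]
  {T : ℝ}

/-- A multiplicative functional of degree `N` (possibly `N = ∞`): a continuous map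
`X = (1, X¹, …, X^N)` on the simplex, with values in the tensor algebra truncated after level `N`,
such that `X_{s,t} = X_{s,u} ⊗ X_{u,t}` there. -/
structure IsMultiplicativeFunctional (N : ℕ∞) (X : Triangle T → ExtTensorAlgebra 𝕜 H) :
    Prop where
  continuous : Continuous X
  zero : ∀ st, X st 0 = HilbertTensorPower.one
  trunc : ∀ st (n : ℕ), N < n → X st n = 0
  chen : ∀ (s r t : ℝ) (h₀ : 0 ≤ s) (hsr : s ≤ r) (hrt : r ≤ t) (hT : t ≤ T) (n : ℕ), n ≤ N →
    X ⟨(s, t), h₀, hsr.trans hrt, hT⟩ n =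
      ExtTensorAlgebra.mul (X ⟨(s, r), h₀, hsr, hrt.trans hT⟩)
        (X ⟨(r, t), h₀.trans hsr, hrt, hT⟩) n

/-- A finite partition `s = t₀ ≤ t₁ ≤ ⋯ ≤ t_m = t`. -/
structure IntervalPartition (s t : ℝ) where
  /-- the number of intervals -/
  m : ℕ
  /-- the partition points -/
  pt : Fin (m + 1) → ℝ
  mono : Monotone pt
  first : pt 0 = s
  last : pt (Fin.last m) = t

/-- The interval number `k` of a partition of `[s, t] ⊆ [0, T]`, as a point of the simplex. -/
def IntervalPartition.piece {st : Triangle T} (P : IntervalPartition st.1.1 st.1.2) (k : Fin P.m) :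
    Triangle T :=
  ⟨(P.pt k.castSucc, P.pt k.succ),
    st.2.1.trans (P.first.ge.trans (P.mono (Fin.zero_le _))),
    P.mono k.castSucc_lt_succ.le,
    (P.mono (Fin.le_last _)).trans (P.last.le.trans st.2.2.2)⟩

/-- `sup_P ∑_{t_k ∈ P} ‖Xⁱ_{t_k, t_{k+1}}‖^{p / i}` over the finite partitions `P` of `[s, t]`. -/
noncomputable def levelVariation (p : ℝ) (X : Triangle T → ExtTensorAlgebra 𝕜 H) (i : ℕ)
    (st : Triangle T) : ℝ≥0∞ :=
  ⨆ P : IntervalPartition st.1.1 st.1.2, ∑ k, ‖X (P.piece k) i‖ₑ ^ (p / i)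

/-- Finite `p`-variation of a multiplicative functional of degree `N` (possibly `N = ∞`): on every
`[s, t] ⊆ [0, T]`, equivalently on `[0, T]`, every level from `1` to `N` has finite variation. -/
def HasFiniteVariation (p : ℝ) (N : ℕ∞) (X : Triangle T → ExtTensorAlgebra 𝕜 H) : Prop :=
  ∀ i : ℕ, 1 ≤ i → i ≤ N → ∀ st, levelVariation p X i st ≠ ∞

/-- A `p`-rough path: a multiplicative functional of degree `⌊p⌋` with finite `p`-variation. -/
def IsRoughPath (p : ℝ) (X : Triangle T → ExtTensorAlgebra 𝕜 H) : Prop :=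
  IsMultiplicativeFunctional (⌊p⌋₊ : ℕ∞) X ∧ HasFiniteVariation p (⌊p⌋₊ : ℕ∞) X

/-- The `p`-variation norm of a `p`-rough path on `[s, t]`:
`max_{1 ≤ i ≤ ⌊p⌋} (sup_P ∑_{t_k ∈ P} ‖Xⁱ_{t_k, t_{k+1}}‖^{p / i})^{1 / p}`. -/
noncomputable def variationNorm (p : ℝ) (X : Triangle T → ExtTensorAlgebra 𝕜 H)
    (st : Triangle T) : ℝ :=
  (⨆ i ∈ Finset.Icc 1 ⌊p⌋₊, levelVariation p X i st).toReal ^ (1 / p)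

/-- `S` is the signature `(1, X¹, …, X^{⌊p⌋}, X^{⌊p⌋+1}, …)` of the `p`-rough path `X`: it extends
`X` to a multiplicative functional with values in `T((H))` and finite `p`-variation. -/
structure IsSignature (p : ℝ) (X S : Triangle T → ExtTensorAlgebra 𝕜 H) : Prop where
  extends_path : ∀ st (n : ℕ), n ≤ ⌊p⌋₊ → S st n = X st n
  multiplicative : IsMultiplicativeFunctional ⊤ S
  finite_variation : HasFiniteVariation p ⊤ S

end RoughPath

/-- The Mittag-Leffler function `E_{α,β}(z) = ∑ₙ zⁿ / (α n + β)!` at real arguments, where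
`x! = Γ(x + 1)`. -/
noncomputable def mittagLeffler (α β z : ℝ) : ℝ :=
  ∑' n : ℕ, z ^ n / Real.Gamma (α * n + β + 1)

/-! ### Algebra of the graded product -/

namespace AlgTensorPower

variable {𝕜 : Type v} [RCLike 𝕜] {H : Type u} [NormedAddCommGroup H] [InnerProductSpace 𝕜 H]

/-! This is Lyons' extension theorem, proved level by level with the sewing lemma. Since the zeroth
levels are `1`, Chen's relation at level `N + 1` says that the new level is additive up to a term
made of the levels `1, …, N` (`mul_succ_apply`). For `Y` of degree `N ≥ ⌊p⌋`, the germ `(Y_{0,s} ⊗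
Y_{s,t})_{N+1}` has additive defect `-(Y_{s,r} ⊗ Y_{r,t})_{N+1}`, by associativity. This is of order
`ω(s,t)^{(N+1)/p}` with an exponent above `1`, so `exists_sewing` yields an additive `I` close to
the germ, and `I` minus the germ is the new level (`exists_extension`).

The constants survive infinitely many steps because of the shape of `levelBound`. The binomial
theorem handles the factor `(x^k / k!)^{1/p}`, and the weights `k⁻²` are stable under convolution up
to the factor `8`; this replaces the neo-classical inequality. A step thus costs `8 / β` times a
sewing constant that is uniform in `N`, and a large `β` makes this at most `1`.

The control is a sum of variations, used only as a superadditive function. Continuity of the new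
level comes instead from uniform convergence of dyadic Riemann sums: the defect is uniformly small
on short intervals, and interpolation (`defect_le_of_small`) trades part of the exponent for a small
constant.

Uniqueness: if two signatures agree below a level `n > ⌊p⌋`, their difference at level `n` is
continuous, additive and of finite variation of order `p / n < 1`, hence zero
(`eq_zero_of_additive_of_sum_rpow_le`). The Mittag-Leffler bound follows from `Γ(n/p + 1) ≤
(n!)^{1/p}`, and the Fock bound from `ℓ¹ ⊆ ℓ²`. -/

theorem mul_assoc {i j k a b n : ℕ} (h₁ : i + j = a) (h₂ : a + k = n) (h₃ : j + k = b)
    (h₄ : i + b = n) (x : AlgTensorPower 𝕜 H i) (y : AlgTensorPower 𝕜 H j)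
    (z : AlgTensorPower 𝕜 H k) : mul h₂ (mul h₁ x y) z = mul h₄ x (mul h₃ y z) := by
  induction x using induction_on with
  | add a b ha hb => simp only [map_add, LinearMap.add_apply, ha, hb]
  | smul_tprod r a =>
  induction y using induction_on with
  | add a b ha hb => simp only [map_add, LinearMap.add_apply, ha, hb]
  | smul_tprod t b =>
  induction z using induction_on with
  | add a b ha hb => simp only [map_add, ha, hb]
  | smul_tprod q c =>
  subst h₁ h₃ h₂
  simp only [map_smul, LinearMap.smul_apply, mul_tprod]
  congr 4
  simpa [Function.comp_def] using
    congrArg (· ∘ Fin.cast (rfl : i + j + k = _)) (Fin.append_assoc a b c)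

theorem one_mul {n : ℕ} (h : 0 + n = n) (x : Fin 0 → H) (y : AlgTensorPower 𝕜 H n) :
    mul h (tprod 0 x) y = y := by
  induction y using induction_on with
  | add a b ha hb => simp only [map_add, ha, hb]
  | smul_tprod t b =>
  obtain rfl : x = Fin.elim0 := Subsingleton.elim _ _
  rw [map_smul, mul_tprod, Fin.elim0_append]
  rfl

theorem mul_one {n : ℕ} (h : n + 0 = n) (x : Fin 0 → H) (y : AlgTensorPower 𝕜 H n) :
    mul h y (tprod 0 x) = y := by
  induction y using induction_on with
  | add a b ha hb => simp only [map_add, LinearMap.add_apply, ha, hb]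
  | smul_tprod t b =>
  obtain rfl : x = Fin.elim0 := Subsingleton.elim _ _
  rw [map_smul, LinearMap.smul_apply, mul_tprod, Fin.append_elim0]
  rfl

end AlgTensorPower

namespace HilbertTensorPower

variable {𝕜 : Type v} [RCLike 𝕜] {H : Type u} [NormedAddCommGroup H] [InnerProductSpace 𝕜 H]

theorem continuous_mul {i j n : ℕ} (h : i + j = n) :
    Continuous fun z : HilbertTensorPower 𝕜 H i × HilbertTensorPower 𝕜 H j => mul h z.1 z.2 :=
  ((mul h).continuous.comp continuous_fst).clm_apply continuous_snd

theorem norm_mul_apply {i j n : ℕ} (h : i + j = n) (x : HilbertTensorPower 𝕜 H i)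
    (y : HilbertTensorPower 𝕜 H j) : ‖mul h x y‖ = ‖x‖ * ‖y‖ := by
  induction x, y using UniformSpace.Completion.induction_on₂ with
  | hp => exact isClosed_eq (continuous_mul h).norm (by fun_prop)
  | ih x y => rw [mul_coe, UniformSpace.Completion.norm_coe, UniformSpace.Completion.norm_coe,
      UniformSpace.Completion.norm_coe, AlgTensorPower.norm_mul_apply]

theorem mul_assoc {i j k a b n : ℕ} (h₁ : i + j = a) (h₂ : a + k = n) (h₃ : j + k = b)
    (h₄ : i + b = n) (x : HilbertTensorPower 𝕜 H i) (y : HilbertTensorPower 𝕜 H j)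
    (z : HilbertTensorPower 𝕜 H k) : mul h₂ (mul h₁ x y) z = mul h₄ x (mul h₃ y z) := by
  induction x, y, z using UniformSpace.Completion.induction_on₃ with
  | hp =>
    refine isClosed_eq ?_ ?_
    · exact (continuous_mul h₂).comp (((continuous_mul h₁).comp
        (continuous_fst.prodMk continuous_snd.fst)).prodMk continuous_snd.snd)
    · exact (continuous_mul h₄).comp (continuous_fst.prodMk ((continuous_mul h₃).comp
        continuous_snd))
  | ih x y z => simp only [mul_coe, AlgTensorPower.mul_assoc h₁ h₂ h₃ h₄]

/-- Reindexing a double sum produces levels such as `n - (b + c)` and `n - b - c`, equal but not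
definitionally so; the index equalities absorb this. -/
theorem mul_assoc_apply (x y z : ExtTensorAlgebra 𝕜 H) {i j k i' j' k' a b n : ℕ} (hi : i = i')
    (hj : j = j') (hk : k = k') (h₁ : i + j = a) (h₂ : a + k = n) (h₃ : j' + k' = b)
    (h₄ : i' + b = n) :
    mul h₂ (mul h₁ (x i) (y j)) (z k) = mul h₄ (x i') (mul h₃ (y j') (z k')) := by
  subst hi hj hk
  exact mul_assoc _ _ _ _ _ _ _

theorem one_mul {n : ℕ} (h : 0 + n = n) (y : HilbertTensorPower 𝕜 H n) : mul h one y = y := by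
  induction y using UniformSpace.Completion.induction_on with
  | hp => exact isClosed_eq (mul h one).continuous continuous_id
  | ih y => rw [one, tprod, mul_coe, AlgTensorPower.one_mul]

theorem mul_one {n : ℕ} (h : n + 0 = n) (y : HilbertTensorPower 𝕜 H n) : mul h y one = y := by
  induction y using UniformSpace.Completion.induction_on with
  | hp => exact isClosed_eq ((continuous_mul (𝕜 := 𝕜) (H := H) h).comp
      (continuous_id.prodMk continuous_const)) continuous_id
  | ih y => rw [one, tprod, mul_coe, AlgTensorPower.mul_one]

theorem norm_one : ‖(one : HilbertTensorPower 𝕜 H 0)‖ = 1 := by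
  have h := inner_tprod (𝕜 := 𝕜) (H := H) Fin.elim0 Fin.elim0
  change inner 𝕜 one one = _ at h
  rw [inner_self_eq_norm_sq_to_K, Finset.univ_eq_empty, Finset.prod_empty] at h
  have h' : ‖(one : HilbertTensorPower 𝕜 H 0)‖ ^ 2 = 1 := by exact_mod_cast h
  exact (pow_eq_one_iff_of_nonneg (norm_nonneg _) two_ne_zero).1 h'

end HilbertTensorPower

namespace ExtTensorAlgebra

variable {𝕜 : Type v} [RCLike 𝕜] {H : Type u} [NormedAddCommGroup H] [InnerProductSpace 𝕜 H]

open HilbertTensorPower (one)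

theorem mul_assoc (x y z : ExtTensorAlgebra 𝕜 H) : mul (mul x y) z = mul x (mul y z) := by
  funext n
  simp only [mul, map_sum, sum_apply]
  rw [Finset.sum_sigma', Finset.sum_sigma']
  -- The pair (joint level `a` of the first two factors, level `b` of the first) corresponds to
  -- (`b`, level `a - b` of the second).
  refine Finset.sum_bij'
    (fun a _ => ⟨⟨a.2, by omega⟩, ⟨a.1 - a.2, by simp only; omega⟩⟩)
    (fun a _ => ⟨⟨a.1 + a.2, by have := a.2.2; omega⟩, ⟨a.1, by simp only; omega⟩⟩)
    (fun _ _ => Finset.mem_univ _) (fun _ _ => Finset.mem_univ _) ?_ ?_ ?_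
  · rintro ⟨⟨a, ha⟩, ⟨b, hb⟩⟩ _
    have : b + (a - b) = a := by simp only at hb; omega
    ext <;> simp only [this]
    exact (Fin.heq_ext_iff (by simp only [this])).2 rfl
  · rintro ⟨⟨a, ha⟩, ⟨b, hb⟩⟩ _
    ext <;> simp
  · rintro ⟨⟨a, ha⟩, ⟨b, hb⟩⟩ _
    simp only at hb
    exact HilbertTensorPower.mul_assoc_apply x y z rfl rfl (by simp only; omega) _ _ _ _

theorem mul_congr {x x' y y' : ExtTensorAlgebra 𝕜 H} {n : ℕ} (hx : ∀ k ≤ n, x k = x' k)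
    (hy : ∀ k ≤ n, y k = y' k) : mul x y n = mul x' y' n :=
  Finset.sum_congr rfl fun k _ => by rw [hx k (by omega), hy (n - k) (by omega)]

theorem mul_zero_apply {x y : ExtTensorAlgebra 𝕜 H} (hx : x 0 = one) (hy : y 0 = one) :
    mul x y 0 = one := by
  simp only [mul, Fin.sum_univ_succ, Fin.sum_univ_zero, add_zero]
  exact (congrArg₂ (fun a b => HilbertTensorPower.mul _ a b) hx hy).trans
    (HilbertTensorPower.one_mul _ _)

/-- The part of `(x ⊗ y)_{n + 1}` that involves only the levels `1, …, n` of `x` and `y`. -/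
noncomputable def midMul (x y : ExtTensorAlgebra 𝕜 H) (n : ℕ) : HilbertTensorPower 𝕜 H (n + 1) :=
  ∑ k : Fin n, HilbertTensorPower.mul (by omega) (x (k + 1)) (y (n - k))

/-- The two extreme terms have a factor `1`. Hence the top level enters Chen's relation additively,
with a correction from lower levels only; both existence and uniqueness rest on this. -/
theorem mul_succ_apply {x y : ExtTensorAlgebra 𝕜 H} (hx : x 0 = one) (hy : y 0 = one) (n : ℕ) :
    mul x y (n + 1) = x (n + 1) + y (n + 1) + midMul x y n := by
  have key : ∀ {i j m : ℕ} (hi : i = m) (hj : j = 0) (h : i + j = m),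
      HilbertTensorPower.mul h (x i) (y j) = x m := by
    rintro i j m rfl rfl h
    rw [hy, HilbertTensorPower.mul_one]
  have key₂ : ∀ {i i' j j' m : ℕ} (hi : i = i') (hj : j = j') (h : i + j = m) (h' : i' + j' = m),
      HilbertTensorPower.mul h (x i) (y j) = HilbertTensorPower.mul h' (x i') (y j') := by
    rintro i _ j _ m rfl rfl h h'
    rfl
  rw [mul, Fin.sum_univ_succ, Fin.sum_univ_castSucc]
  have e₀ : HilbertTensorPower.mul (Nat.add_sub_of_le (Nat.lt_succ_iff.1 (0 : Fin (n + 2)).2))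
      (x (0 : Fin (n + 2))) (y (n + 1 - (0 : Fin (n + 2)))) = y (n + 1) :=
    (congrArg (fun a => HilbertTensorPower.mul (Nat.zero_add _) a (y (n + 1))) hx).trans
      (HilbertTensorPower.one_mul _ _)
  rw [e₀, key (by simp) (by simp) _, midMul]
  have : ∀ k : Fin n, HilbertTensorPower.mul
      (Nat.add_sub_of_le (Nat.lt_succ_iff.1 k.castSucc.succ.2)) (x k.castSucc.succ)
      (y (n + 1 - k.castSucc.succ)) =
        HilbertTensorPower.mul (by omega) (x (k + 1)) (y (n - k)) :=
    fun k => key₂ (by simp) (by simp) _ _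
  simp only [this]
  abel

theorem midMul_congr {x x' y y' : ExtTensorAlgebra 𝕜 H} {n : ℕ} (hx : ∀ k ≤ n, x k = x' k)
    (hy : ∀ k ≤ n, y k = y' k) : midMul x y n = midMul x' y' n :=
  Finset.sum_congr rfl fun k _ => by rw [hx (k + 1) (by omega), hy (n - k) (by omega)]

theorem norm_midMul_le (x y : ExtTensorAlgebra 𝕜 H) (n : ℕ) :
    ‖midMul x y n‖ ≤ ∑ k ∈ Finset.range n, ‖x (k + 1)‖ * ‖y (n - k)‖ := by
  rw [Finset.sum_range fun k => ‖x (k + 1)‖ * ‖y (n - k)‖]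
  exact (norm_sum_le _ _).trans_eq
    (Finset.sum_congr rfl fun k _ => HilbertTensorPower.norm_mul_apply _ _ _)

theorem continuous_midMul (n : ℕ) :
    Continuous fun z : ExtTensorAlgebra 𝕜 H × ExtTensorAlgebra 𝕜 H => midMul z.1 z.2 n :=
  continuous_finsetSum _ fun _ _ => (HilbertTensorPower.continuous_mul _).comp
    (((continuous_apply _).comp continuous_fst).prodMk ((continuous_apply _).comp continuous_snd))

end ExtTensorAlgebra

/-! ### Controls and the sewing lemma -/

/-- A superadditive function of intervals (no continuity is required). -/
structure IsControl (ω : ℝ → ℝ → ℝ) : Prop where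
  nonneg : ∀ {s t}, s ≤ t → 0 ≤ ω s t
  superadd : ∀ {s r t}, s ≤ r → r ≤ t → ω s r + ω r t ≤ ω s t

namespace IsControl

variable {ω : ℝ → ℝ → ℝ} (hω : IsControl ω)
include hω

theorem apply_self (s : ℝ) : ω s s = 0 := by
  have h₁ := hω.superadd (le_refl s) (le_refl s)
  have h₂ := hω.nonneg (le_refl s)
  linarith

theorem mono {a s t b : ℝ} (h₁ : a ≤ s) (h₂ : s ≤ t) (h₃ : t ≤ b) : ω s t ≤ ω a b := by
  have h₄ := hω.superadd h₁ (h₂.trans h₃)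
  have h₅ := hω.superadd h₂ h₃
  have h₆ := hω.nonneg h₁
  have h₇ := hω.nonneg h₃
  linarith

theorem const_mul {c : ℝ} (hc : 0 ≤ c) : IsControl fun s t => c * ω s t where
  nonneg h := mul_nonneg hc (hω.nonneg h)
  superadd h h' := by
    rw [← mul_add]
    exact mul_le_mul_of_nonneg_left (hω.superadd h h') hc

theorem sum_le {τ : ℕ → ℝ} (hτ : Monotone τ) (m : ℕ) :
    ∑ i ∈ Finset.range m, ω (τ i) (τ (i + 1)) ≤ ω (τ 0) (τ m) := by
  induction m with
  | zero => simpa using hω.nonneg le_rfl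
  | succ m ih =>
    rw [Finset.sum_range_succ]
    have := hω.superadd (hτ m.zero_le) (hτ m.le_succ)
    linarith

/-- The overlapping intervals split by parity into two chains of adjacent ones; each induction step
prolongs the chain that ends at `τ m`. -/
theorem sum_skip_le {τ : ℕ → ℝ} (hτ : Monotone τ) (m : ℕ) :
    ∑ i ∈ Finset.range m, ω (τ i) (τ (i + 2)) ≤ ω (τ 0) (τ m) + ω (τ 0) (τ (m + 1)) := by
  induction m with
  | zero =>
    have h₁ := hω.nonneg (le_refl (τ 0))
    have h₂ := hω.nonneg (hτ (Nat.zero_le 1))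
    simpa using add_nonneg h₁ h₂
  | succ m ih =>
    rw [Finset.sum_range_succ]
    have := hω.superadd (hτ m.zero_le) (hτ (by omega : m ≤ m + 2))
    linarith

theorem sum_rpow_le {τ : ℕ → ℝ} (hτ : Monotone τ) {θ : ℝ} (hθ : 1 ≤ θ) (m : ℕ) :
    ∑ i ∈ Finset.range m, ω (τ i) (τ (i + 1)) ^ θ ≤ ω (τ 0) (τ m) ^ θ := by
  have hW := hω.nonneg (hτ m.zero_le)
  have split : ∀ x : ℝ, 0 ≤ x → x ^ θ = x * x ^ (θ - 1) := fun x hx => by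
    rw [← Real.rpow_one_add' hx (by linarith)]
    ring_nf
  calc ∑ i ∈ Finset.range m, ω (τ i) (τ (i + 1)) ^ θ
      ≤ ∑ i ∈ Finset.range m, ω (τ i) (τ (i + 1)) * ω (τ 0) (τ m) ^ (θ - 1) := by
        refine Finset.sum_le_sum fun i hi => ?_
        have h₀ := hω.nonneg (hτ i.le_succ)
        rw [split _ h₀]
        refine mul_le_mul_of_nonneg_left (Real.rpow_le_rpow h₀ ?_ (by linarith)) h₀
        exact hω.mono (hτ i.zero_le) (hτ i.le_succ) (hτ (Finset.mem_range.1 hi))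
    _ ≤ ω (τ 0) (τ m) ^ θ := by
        rw [← Finset.sum_mul, split _ hW]
        exact mul_le_mul_of_nonneg_right (hω.sum_le hτ m) (Real.rpow_nonneg hW _)

end IsControl

/-- The terms of the series that defines `sewingConst`. -/
noncomputable def sewingTerm (θ : ℝ) (r : ℕ) : ℝ := min 1 (2 / ((r : ℝ) + 1)) ^ θ

/-- The constant of the sewing lemma. -/
noncomputable def sewingConst (θ : ℝ) : ℝ := ∑' r, sewingTerm θ r

theorem sewingTerm_nonneg (θ : ℝ) (r : ℕ) : 0 ≤ sewingTerm θ r := by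
  unfold sewingTerm
  positivity

theorem sewingConst_nonneg (θ : ℝ) : 0 ≤ sewingConst θ := tsum_nonneg (sewingTerm_nonneg θ)

theorem summable_sewingTerm {θ : ℝ} (hθ : 1 < θ) : Summable (sewingTerm θ) := by
  have h : Summable fun r : ℕ => (2 : ℝ) ^ θ * (((r + 1 : ℕ) : ℝ) ^ θ)⁻¹ :=
    ((summable_nat_add_iff 1).2 (Real.summable_nat_rpow_inv.2 hθ)).mul_left _
  refine Summable.of_nonneg_of_le (sewingTerm_nonneg θ) (fun r => ?_) h
  rw [← div_eq_mul_inv, ← Real.div_rpow (by norm_num) (by positivity)]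
  push_cast
  exact Real.rpow_le_rpow (by positivity) (min_le_right _ _) (by linarith)

/-- The cap `min 1` makes the terms decrease in the exponent, so one constant serves every level of
the extension. -/
theorem sum_sewingTerm_le {θ₀ θ : ℝ} (hθ₀ : 1 < θ₀) (hθ : θ₀ ≤ θ) (m : ℕ) :
    ∑ r ∈ Finset.range m, sewingTerm θ r ≤ sewingConst θ₀ :=
  (Finset.sum_le_sum fun r _ => Real.rpow_le_rpow_of_exponent_ge' (by positivity)
    (min_le_left _ _) (by linarith) hθ).trans
    ((summable_sewingTerm hθ₀).sum_le_tsum _ fun r _ => sewingTerm_nonneg θ₀ r)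

section Sewing

variable {E : Type*} [NormedAddCommGroup E]

/-- The failure of additivity of a function of intervals. -/
def additiveDefect (A : ℝ → ℝ → E) (s r t : ℝ) : E := A s t - A s r - A r t

/-- The sequence `τ` without its point of index `j + 1`. -/
def skipPoint (τ : ℕ → ℝ) (j i : ℕ) : ℝ := if i ≤ j then τ i else τ (i + 1)

theorem skipPoint_of_le (τ : ℕ → ℝ) {j i : ℕ} (h : i ≤ j) : skipPoint τ j i = τ i := if_pos h

theorem skipPoint_of_lt (τ : ℕ → ℝ) {j i : ℕ} (h : j < i) : skipPoint τ j i = τ (i + 1) :=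
  if_neg (by omega)

theorem monotone_skipPoint {τ : ℕ → ℝ} (hτ : Monotone τ) (j : ℕ) : Monotone (skipPoint τ j) := by
  intro p q hpq
  unfold skipPoint
  split_ifs
  · exact hτ hpq
  · exact hτ (by omega)
  · omega
  · exact hτ (by omega)

/-- Removing one interior point merges two intervals, so the Riemann sum changes by exactly one
defect. -/
theorem sum_range_skipPoint (A : ℝ → ℝ → E) (τ : ℕ → ℝ) (j k : ℕ) :
    ∑ i ∈ Finset.range (j + 2 + k), A (τ i) (τ (i + 1)) =
      ∑ i ∈ Finset.range (j + 1 + k), A (skipPoint τ j i) (skipPoint τ j (i + 1)) -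
        additiveDefect A (τ j) (τ (j + 1)) (τ (j + 2)) := by
  rw [Finset.sum_range_add _ (j + 2), Finset.sum_range_add _ (j + 1),
    Finset.sum_range_succ _ (j + 1), Finset.sum_range_succ _ j, Finset.sum_range_succ _ j]
  have h₁ : ∀ i ∈ Finset.range j, A (skipPoint τ j i) (skipPoint τ j (i + 1)) =
      A (τ i) (τ (i + 1)) := by
    intro i hi
    have : i < j := Finset.mem_range.1 hi
    rw [skipPoint_of_le τ this.le, skipPoint_of_le τ this]
  have h₂ : ∀ i ∈ Finset.range k, A (skipPoint τ j (j + 1 + i)) (skipPoint τ j (j + 1 + i + 1)) =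
      A (τ (j + 2 + i)) (τ (j + 2 + i + 1)) := by
    intro i _
    rw [skipPoint_of_lt τ (by omega), skipPoint_of_lt τ (by omega)]
    congr 2 <;> omega
  rw [Finset.sum_congr rfl h₁, Finset.sum_congr rfl h₂, skipPoint_of_le τ le_rfl,
    skipPoint_of_lt τ j.lt_succ_self, additiveDefect]
  abel

/-- The maximal inequality: Riemann sums of an almost additive function of intervals. -/
theorem norm_sum_sub_le_sum {ω : ℝ → ℝ → ℝ} (hω : IsControl ω) {A : ℝ → ℝ → E} {D θ a b : ℝ}
    (hD : 0 ≤ D) (hθ : 0 ≤ θ)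
    (hA : ∀ s r t, a ≤ s → s ≤ r → r ≤ t → t ≤ b → ‖additiveDefect A s r t‖ ≤ D * ω s t ^ θ)
    (m : ℕ) {τ : ℕ → ℝ} (hτ : Monotone τ) (ha : τ 0 = a) (hb : τ (m + 1) = b) :
    ‖∑ i ∈ Finset.range (m + 1), A (τ i) (τ (i + 1)) - A a b‖ ≤
      D * (∑ r ∈ Finset.range m, sewingTerm θ r) * ω a b ^ θ := by
  induction m generalizing τ with
  | zero => simp [← ha, ← hb]
  | succ m ih =>
    have hab : a ≤ b := ha ▸ hb ▸ hτ (Nat.zero_le _)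
    have hW : 0 ≤ ω a b := hω.nonneg hab
    -- Young's pigeonhole: the `m + 1` pairs of adjacent intervals have total control at most `2
    -- ω(a,b)`, so some interior point is cheap to remove.
    obtain ⟨j, hj, hle⟩ : ∃ j ∈ Finset.range (m + 1),
        ω (τ j) (τ (j + 2)) ≤ 2 / ((m : ℝ) + 1) * ω a b := by
      refine Finset.exists_le_of_sum_le ⟨0, by simp⟩ ?_
      rw [Finset.sum_const, Finset.card_range, nsmul_eq_mul]
      have h₁ := hω.sum_skip_le hτ (m + 1)
      have h₂ : ω (τ 0) (τ (m + 1)) ≤ ω a b :=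
        hω.mono ha.ge (hτ (Nat.zero_le _)) (hb ▸ hτ (by omega))
      rw [ha, hb] at h₁
      rw [ha] at h₂
      have h₃ : ((m + 1 : ℕ) : ℝ) * (2 / ((m : ℝ) + 1) * ω a b) = 2 * ω a b := by
        push_cast
        field_simp
      linarith
    have hj' : j < m + 1 := Finset.mem_range.1 hj
    obtain ⟨k, rfl⟩ : ∃ k, m = j + k := ⟨m - j, by omega⟩
    have key := ih (monotone_skipPoint hτ j) ((skipPoint_of_le τ j.zero_le).trans ha)
      ((skipPoint_of_lt τ hj').trans hb)
    have hdef : ‖additiveDefect A (τ j) (τ (j + 1)) (τ (j + 2))‖ ≤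
        D * sewingTerm θ (j + k) * ω a b ^ θ := by
      have hja : a ≤ τ j := ha ▸ hτ (Nat.zero_le _)
      have hjb : τ (j + 2) ≤ b := hb ▸ hτ (by omega)
      refine (hA _ _ _ hja (hτ (by omega)) (hτ (by omega)) hjb).trans ?_
      rw [mul_assoc, sewingTerm, ← Real.mul_rpow (by positivity) hW]
      refine mul_le_mul_of_nonneg_left (Real.rpow_le_rpow (hω.nonneg (hτ (by omega))) ?_ hθ) hD
      rw [min_mul_of_nonneg _ _ hW, one_mul]
      exact le_min (hω.mono hja (hτ (by omega)) hjb) hle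
    have hsum := sum_range_skipPoint A τ j k
    rw [show j + k + 1 + 1 = j + 2 + k by ring, hsum, show j + 1 + k = j + k + 1 by ring,
      Finset.sum_range_succ (sewingTerm θ) (j + k), sub_right_comm]
    refine (norm_sub_le _ _).trans ((add_le_add key hdef).trans_eq ?_)
    ring

theorem norm_sum_sub_le {ω : ℝ → ℝ → ℝ} (hω : IsControl ω) {A : ℝ → ℝ → E} {D θ₀ θ a b : ℝ}
    (hD : 0 ≤ D) (hθ₀ : 1 < θ₀) (hθ : θ₀ ≤ θ)
    (hA : ∀ s r t, a ≤ s → s ≤ r → r ≤ t → t ≤ b → ‖additiveDefect A s r t‖ ≤ D * ω s t ^ θ)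
    {m : ℕ} (hm : 0 < m) {τ : ℕ → ℝ} (hτ : Monotone τ) (ha : τ 0 = a) (hb : τ m = b) :
    ‖∑ i ∈ Finset.range m, A (τ i) (τ (i + 1)) - A a b‖ ≤ D * sewingConst θ₀ * ω a b ^ θ := by
  obtain ⟨m, rfl⟩ := Nat.exists_eq_succ_of_ne_zero hm.ne'
  have hab : a ≤ b := ha ▸ hb ▸ hτ (Nat.zero_le _)
  refine (norm_sum_sub_le_sum hω hD (by linarith) hA m hτ ha hb).trans ?_
  have := Real.rpow_nonneg (hω.nonneg hab) θ
  gcongr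
  exact sum_sewingTerm_le hθ₀ hθ m

theorem apply_self_eq_zero_of_defect {ω : ℝ → ℝ → ℝ} (hω : IsControl ω) {A : ℝ → ℝ → E}
    {D θ : ℝ} (hθ : 0 < θ)
    (hA : ∀ s r t, s ≤ r → r ≤ t → ‖additiveDefect A s r t‖ ≤ D * ω s t ^ θ) (s : ℝ) :
    A s s = 0 := by
  have h := hA s s s le_rfl le_rfl
  rw [hω.apply_self, Real.zero_rpow hθ.ne', mul_zero] at h
  simpa [additiveDefect] using h

/-- Interpolation: an almost additive function of intervals whose defect is uniformly small on short
intervals also has a small defect relative to a slightly smaller power of the control. -/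
theorem defect_le_of_small {ω : ℝ → ℝ → ℝ} (hω : IsControl ω) {A : ℝ → ℝ → E} {D θ : ℝ}
    (hD : 0 ≤ D) (hθ : 1 < θ)
    (hA : ∀ s r t, s ≤ r → r ≤ t → ‖additiveDefect A s r t‖ ≤ D * ω s t ^ θ)
    (hsmall : ∀ ε > 0, ∃ δ > 0, ∀ s r t, s ≤ r → r ≤ t → t - s ≤ δ →
      ‖additiveDefect A s r t‖ ≤ ε) {ε : ℝ} (hε : 0 < ε) :
    ∃ δ > 0, ∀ s r t, s ≤ r → r ≤ t → t - s ≤ δ →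
      ‖additiveDefect A s r t‖ ≤ ε * ω s t ^ ((1 + θ) / 2) := by
  -- Chosen so that `η < 1` while `θ η = (1 + θ) / 2` is still above `1`.
  set η := (1 + θ) / (2 * θ) with hη
  have hη₀ : 0 < η := by positivity
  have hη₁ : 0 < 1 - η := by
    rw [hη, sub_pos, div_lt_one (by linarith)]
    linarith
  have hDη : 0 ≤ D ^ η := Real.rpow_nonneg hD _
  have hq : 0 < ε / (D ^ η + 1) := by positivity
  -- The threshold makes the factor of power `1 - η` at most `ε / (D ^ η + 1)`, which absorbs the `D
  -- ^ η` left by the other factor; the `+ 1` covers `D = 0`.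
  obtain ⟨δ, hδ, h⟩ := hsmall ((ε / (D ^ η + 1)) ^ (1 - η)⁻¹) (Real.rpow_pos_of_pos hq _)
  refine ⟨δ, hδ, fun s r t hsr hrt hst => ?_⟩
  have hW := hω.nonneg (hsr.trans hrt)
  have hx := norm_nonneg (additiveDefect A s r t)
  calc ‖additiveDefect A s r t‖
      = ‖additiveDefect A s r t‖ ^ (1 - η) * ‖additiveDefect A s r t‖ ^ η := by
        rw [← Real.rpow_add' hx (by norm_num)]
        norm_num
    _ ≤ (ε / (D ^ η + 1)) * (D * ω s t ^ θ) ^ η := by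
        refine mul_le_mul ?_ (Real.rpow_le_rpow hx (hA s r t hsr hrt) hη₀.le)
          (Real.rpow_nonneg hx _) hq.le
        refine (Real.rpow_le_rpow hx (h s r t hsr hrt hst) hη₁.le).trans_eq ?_
        exact Real.rpow_inv_rpow hq.le hη₁.ne'
    _ = ε * (D ^ η / (D ^ η + 1)) * ω s t ^ ((1 + θ) / 2) := by
        rw [Real.mul_rpow hD (Real.rpow_nonneg hW _), ← Real.rpow_mul hW,
          show θ * η = (1 + θ) / 2 by rw [hη]; field_simp]
        ring
    _ ≤ ε * ω s t ^ ((1 + θ) / 2) := by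
        refine mul_le_mul_of_nonneg_right ?_ (Real.rpow_nonneg hW _)
        refine mul_le_of_le_one_right hε.le ?_
        rw [div_le_one (by positivity)]
        linarith

/-! ### Riemann sums over dyadic grids. -/

theorem sum_range_mul_eq {M : Type*} [AddCommMonoid M] (f : ℕ → M) (a b : ℕ) :
    ∑ j ∈ Finset.range (a * b), f j =
      ∑ i ∈ Finset.range a, ∑ l ∈ Finset.range b, f (i * b + l) := by
  induction a with
  | zero => simp
  | succ a ih => rw [Nat.succ_mul, Finset.sum_range_add, ih, Finset.sum_range_succ]

/-- The dyadic grid of `[0, T]`. -/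
noncomputable def dyadicGrid (T : ℝ) (N j : ℕ) : ℝ := j * T / 2 ^ N

/-- The dyadic grid of `[0, T]`, projected to `[s, t]`. -/
noncomputable def clampedGrid (T s t : ℝ) (N j : ℕ) : ℝ := max s (min t (dyadicGrid T N j))

section Grid

variable {T s r t : ℝ}

theorem dyadicGrid_mul (N M i : ℕ) : dyadicGrid T (N + M) (i * 2 ^ M) = dyadicGrid T N i := by
  simp only [dyadicGrid, pow_add]
  push_cast
  field_simp

theorem monotone_dyadicGrid (hT : 0 ≤ T) (N : ℕ) : Monotone (dyadicGrid T N) := by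
  intro i j h
  unfold dyadicGrid
  gcongr

theorem monotone_clampedGrid (hT : 0 ≤ T) (N : ℕ) : Monotone (clampedGrid T s t N) :=
  fun _ _ h => max_le_max le_rfl (min_le_min le_rfl (monotone_dyadicGrid hT N h))

theorem clampedGrid_mul (N M i : ℕ) :
    clampedGrid T s t (N + M) (i * 2 ^ M) = clampedGrid T s t N i := by
  rw [clampedGrid, dyadicGrid_mul, clampedGrid]

theorem clampedGrid_zero (hs : 0 ≤ s) (hst : s ≤ t) (N : ℕ) : clampedGrid T s t N 0 = s := by
  simp [clampedGrid, dyadicGrid, hs, hs.trans hst]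

theorem clampedGrid_last (hst : s ≤ t) (ht : t ≤ T) (N : ℕ) :
    clampedGrid T s t N (2 ^ N) = t := by
  simp [clampedGrid, dyadicGrid, hst, ht]

theorem clampedGrid_succ_sub_le (hT : 0 ≤ T) (N j : ℕ) :
    clampedGrid T s t N (j + 1) - clampedGrid T s t N j ≤ T / 2 ^ N := by
  have h : dyadicGrid T N (j + 1) = dyadicGrid T N j + T / 2 ^ N := by
    simp only [dyadicGrid]
    push_cast
    ring
  have h₀ : 0 ≤ T / 2 ^ N := by positivity
  rw [sub_le_iff_le_add, clampedGrid, clampedGrid, h]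
  refine max_le ?_ ?_
  · linarith [le_max_left s (min t (dyadicGrid T N j))]
  · refine le_trans ?_ (add_le_add le_rfl (le_max_right _ _))
    rw [← min_add_add_left]
    exact min_le_min (by linarith) (by linarith)

/-- With `clampedGrid_right`, this lets the Riemann sums over `[s, r]`, `[r, t]` and `[s, t]` be
compared cell by cell. It is why one grid of `[0, T]` is used instead of a grid for each interval.
-/
theorem clampedGrid_left (hrt : r ≤ t) (hsr : s ≤ r) (N j : ℕ) :
    clampedGrid T s r N j = min (clampedGrid T s t N j) r := by
  rw [clampedGrid, clampedGrid, min_max_distrib_right, min_eq_left hsr, min_right_comm,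
    min_eq_right hrt]

theorem clampedGrid_right (hsr : s ≤ r) (N j : ℕ) :
    clampedGrid T r t N j = max (clampedGrid T s t N j) r := by
  rw [clampedGrid, clampedGrid, max_right_comm, max_eq_right hsr]

theorem continuous_clampedGrid (N j : ℕ) :
    Continuous fun x : ℝ × ℝ => clampedGrid T x.1 x.2 N j := by
  unfold clampedGrid
  fun_prop

theorem exists_div_two_pow_le (T : ℝ) {δ : ℝ} (hδ : 0 < δ) : ∃ N, ∀ n ≥ N, T / 2 ^ n ≤ δ := by
  have h : Filter.Tendsto (fun n : ℕ => T * (1 / 2 : ℝ) ^ n) Filter.atTop (nhds (T * 0)) :=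
    (tendsto_pow_atTop_nhds_zero_of_lt_one (by norm_num) (by norm_num)).const_mul T
  rw [mul_zero] at h
  obtain ⟨N, hN⟩ := Filter.eventually_atTop.1 (h.eventually (ge_mem_nhds hδ))
  refine ⟨N, fun n hn => ?_⟩
  simpa [div_eq_mul_inv] using hN n hn

end Grid

/-- The Riemann sum over the dyadic grid of `[0, T]`, projected to `[s, t]`. -/
noncomputable def dyadicSum (T : ℝ) (A : ℝ → ℝ → E) (N : ℕ) (s t : ℝ) : E :=
  ∑ j ∈ Finset.range (2 ^ N), A (clampedGrid T s t N j) (clampedGrid T s t N (j + 1))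

theorem continuous_dyadicSum (T : ℝ) {A : ℝ → ℝ → E} (hA : Continuous (Function.uncurry A))
    (N : ℕ) : Continuous fun x : ℝ × ℝ => dyadicSum T A N x.1 x.2 :=
  continuous_finsetSum _ fun j _ =>
    hA.comp ((continuous_clampedGrid N j).prodMk (continuous_clampedGrid N (j + 1)))

/-- The finer grid subdivides each coarse cell, so the maximal inequality applies cell by cell, and
superadditivity sums the errors. The bound is free of `M`, `s` and `t`, which gives a uniform Cauchy
property. -/
theorem norm_dyadicSum_add_sub_le {ω : ℝ → ℝ → ℝ} (hω : IsControl ω) {A : ℝ → ℝ → E}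
    {T ε δ θ : ℝ} (hT : 0 ≤ T) (hε : 0 ≤ ε) (hθ : 1 < θ)
    (hA : ∀ s r t, s ≤ r → r ≤ t → t - s ≤ δ → ‖additiveDefect A s r t‖ ≤ ε * ω s t ^ θ)
    {N : ℕ} (hN : T / 2 ^ N ≤ δ) (M : ℕ) {s t : ℝ} (hs : 0 ≤ s) (hst : s ≤ t) (ht : t ≤ T) :
    ‖dyadicSum T A (N + M) s t - dyadicSum T A N s t‖ ≤
      ε * sewingConst θ * ω 0 T ^ θ := by
  have hmono : Monotone (clampedGrid T s t N) := monotone_clampedGrid hT N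
  have hcε : 0 ≤ ε * sewingConst θ := mul_nonneg hε (sewingConst_nonneg θ)
  rw [dyadicSum, dyadicSum, pow_add, sum_range_mul_eq, ← Finset.sum_sub_distrib]
  calc _ ≤ ∑ i ∈ Finset.range (2 ^ N), ε * sewingConst θ *
        ω (clampedGrid T s t N i) (clampedGrid T s t N (i + 1)) ^ θ := by
        refine (norm_sum_le _ _).trans (Finset.sum_le_sum fun i _ => ?_)
        refine norm_sum_sub_le hω hε hθ le_rfl (fun a b c h₁ h₂ h₃ h₄ => hA a b c h₂ h₃ ?_)
          (τ := fun l => clampedGrid T s t (N + M) (i * 2 ^ M + l)) (by positivity)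
          (fun a b h => monotone_clampedGrid hT _ (by omega)) ?_ ?_
        · have := clampedGrid_succ_sub_le (s := s) (t := t) hT N i
          linarith
        · exact clampedGrid_mul N M i
        · rw [← clampedGrid_mul N M (i + 1), Nat.succ_mul]
    _ ≤ ε * sewingConst θ * ω s t ^ θ := by
        rw [← Finset.mul_sum]
        refine mul_le_mul_of_nonneg_left ?_ hcε
        have := hω.sum_rpow_le hmono hθ.le (2 ^ N)
        rwa [clampedGrid_zero hs hst, clampedGrid_last hst ht] at this
    _ ≤ _ := by
        refine mul_le_mul_of_nonneg_left ?_ hcε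
        exact Real.rpow_le_rpow (hω.nonneg hst) (hω.mono hs hst ht) (by linarith)

/-- A cell on one side of `r` cancels because `A` vanishes on the diagonal; a cell containing `r`
contributes one defect of a short interval. -/
theorem norm_dyadicSum_additiveDefect_le {ω : ℝ → ℝ → ℝ} (hω : IsControl ω) {A : ℝ → ℝ → E}
    {T ε δ θ : ℝ} (hT : 0 ≤ T) (hε : 0 ≤ ε) (hθ : 1 < θ) (h₀ : ∀ s, A s s = 0)
    (hA : ∀ s r t, s ≤ r → r ≤ t → t - s ≤ δ → ‖additiveDefect A s r t‖ ≤ ε * ω s t ^ θ)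
    {N : ℕ} (hN : T / 2 ^ N ≤ δ) {s r t : ℝ} (hs : 0 ≤ s) (hsr : s ≤ r) (hrt : r ≤ t)
    (ht : t ≤ T) :
    ‖additiveDefect (dyadicSum T A N) s r t‖ ≤ ε * ω 0 T ^ θ := by
  have hst := hsr.trans hrt
  have hmono : Monotone (clampedGrid T s t N) := monotone_clampedGrid hT N
  simp only [additiveDefect, dyadicSum]
  rw [← Finset.sum_sub_distrib, ← Finset.sum_sub_distrib]
  calc _ ≤ ∑ i ∈ Finset.range (2 ^ N), ε *
        ω (clampedGrid T s t N i) (clampedGrid T s t N (i + 1)) ^ θ := by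
        refine (norm_sum_le _ _).trans (Finset.sum_le_sum fun i _ => ?_)
        have hle := hmono i.le_succ
        have hpos : 0 ≤ ε * ω (clampedGrid T s t N i) (clampedGrid T s t N (i + 1)) ^ θ :=
          mul_nonneg hε (Real.rpow_nonneg (hω.nonneg hle) _)
        have hd := (clampedGrid_succ_sub_le (s := s) (t := t) hT N i).trans hN
        rw [clampedGrid_left hrt hsr, clampedGrid_left hrt hsr, clampedGrid_right hsr,
          clampedGrid_right hsr]
        rcases le_total r (clampedGrid T s t N i) with h | h
        · rw [min_eq_right h, min_eq_right (h.trans hle), max_eq_left h,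
            max_eq_left (h.trans hle), h₀]
          simpa using hpos
        rcases le_total r (clampedGrid T s t N (i + 1)) with h' | h'
        · rw [min_eq_left h, min_eq_right h', max_eq_right h, max_eq_left h']
          exact hA _ _ _ h h' hd
        · rw [min_eq_left h, min_eq_left h', max_eq_right h, max_eq_right h', h₀]
          simpa using hpos
    _ ≤ ε * ω s t ^ θ := by
        rw [← Finset.mul_sum]
        refine mul_le_mul_of_nonneg_left ?_ hε
        have := hω.sum_rpow_le hmono hθ.le (2 ^ N)
        rwa [clampedGrid_zero hs hst, clampedGrid_last hst ht] at this
    _ ≤ _ := by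
        refine mul_le_mul_of_nonneg_left ?_ hε
        exact Real.rpow_le_rpow (hω.nonneg hst) (hω.mono hs hst ht) (by linarith)

/-- The sewing lemma. -/
theorem exists_sewing [CompleteSpace E] {ω : ℝ → ℝ → ℝ} (hω : IsControl ω) {A : ℝ → ℝ → E}
    (hcont : Continuous (Function.uncurry A)) {D θ₀ θ : ℝ} (hD : 0 ≤ D) (hθ₀ : 1 < θ₀)
    (hθ : θ₀ ≤ θ)
    (hA : ∀ s r t, s ≤ r → r ≤ t → ‖additiveDefect A s r t‖ ≤ D * ω s t ^ θ)
    (hsmall : ∀ ε > 0, ∃ δ > 0, ∀ s r t, s ≤ r → r ≤ t → t - s ≤ δ →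
      ‖additiveDefect A s r t‖ ≤ ε) {T : ℝ} (hT : 0 ≤ T) :
    ∃ I : ℝ → ℝ → E, ContinuousOn (Function.uncurry I) (Triangle T) ∧
      (∀ s r t, 0 ≤ s → s ≤ r → r ≤ t → t ≤ T → additiveDefect I s r t = 0) ∧
      ∀ s t, 0 ≤ s → s ≤ t → t ≤ T →
        ‖I s t - A s t‖ ≤ D * sewingConst θ₀ * ω s t ^ θ := by
  set θ' := (1 + θ) / 2 with hθ'_def
  have hθ' : 1 < θ' := by rw [hθ'_def]; linarith
  have hdef : ∀ ε > 0, ∃ δ > 0, ∀ s r t, s ≤ r → r ≤ t → t - s ≤ δ →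
      ‖additiveDefect A s r t‖ ≤ ε * ω s t ^ θ' :=
    fun ε hε => defect_le_of_small hω hD (by linarith) hA hsmall hε
  have h₀ : ∀ s, A s s = 0 := apply_self_eq_zero_of_defect hω (by linarith) hA
  -- A positive number that dominates the constants of both grid estimates.
  set B := (sewingConst θ' + 1) * (ω 0 T ^ θ' + 1) with hB
  have hW' : 0 ≤ ω 0 T ^ θ' := Real.rpow_nonneg (hω.nonneg hT) _
  have hK' := sewingConst_nonneg θ'
  have hBpos : 0 < B := by positivity
  have hBK : sewingConst θ' * ω 0 T ^ θ' ≤ B := by rw [hB]; nlinarith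
  have hBW : ω 0 T ^ θ' ≤ B := by rw [hB]; nlinarith
  have hgrid : ∀ ε > 0, ∃ N, ∀ n ≥ N,
      (∀ M s t, 0 ≤ s → s ≤ t → t ≤ T →
        ‖dyadicSum T A (n + M) s t - dyadicSum T A n s t‖ ≤ ε) ∧
      ∀ s r t, 0 ≤ s → s ≤ r → r ≤ t → t ≤ T →
        ‖additiveDefect (dyadicSum T A n) s r t‖ ≤ ε := by
    intro ε hε
    obtain ⟨δ, hδ, h⟩ := hdef (ε / B) (by positivity)
    obtain ⟨N, hN⟩ := exists_div_two_pow_le T hδ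
    have hεB : 0 ≤ ε / B := by positivity
    refine ⟨N, fun n hn => ⟨fun M s t hs hst ht => ?_, fun s r t hs hsr hrt ht => ?_⟩⟩
    · refine (norm_dyadicSum_add_sub_le hω hT hεB hθ' h (hN n hn) M hs hst ht).trans ?_
      rw [mul_assoc, div_mul_eq_mul_div, div_le_iff₀ hBpos]
      exact mul_le_mul_of_nonneg_left hBK hε.le
    · refine (norm_dyadicSum_additiveDefect_le hω hT hεB hθ' h₀ h (hN n hn) hs hsr hrt
        ht).trans ?_
      rw [div_mul_eq_mul_div, div_le_iff₀ hBpos]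
      exact mul_le_mul_of_nonneg_left hBW hε.le
  -- The limit is chosen at every point of the plane, with junk value `0` off the simplex.
  have hlim : ∀ x : ℝ × ℝ, ∃ y, x ∈ Triangle T →
      Filter.Tendsto (fun n => dyadicSum T A n x.1 x.2) Filter.atTop (nhds y) := by
    intro x
    by_cases hx : x ∈ Triangle T
    · have : CauchySeq fun n => dyadicSum T A n x.1 x.2 := by
        refine Metric.cauchySeq_iff'.2 fun ε hε => ?_
        obtain ⟨N, hN⟩ := hgrid (ε / 2) (by positivity)
        refine ⟨N, fun n hn => ?_⟩
        obtain ⟨M, rfl⟩ := Nat.exists_eq_add_of_le hn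
        rw [dist_eq_norm]
        exact ((hN N le_rfl).1 M _ _ hx.1 hx.2.1 hx.2.2).trans_lt (by linarith)
      obtain ⟨y, hy⟩ := cauchySeq_tendsto_of_complete this
      exact ⟨y, fun _ => hy⟩
    · exact ⟨0, fun h => absurd h hx⟩
  choose J hJ using hlim
  have hI : ∀ s t, 0 ≤ s → s ≤ t → t ≤ T →
      Filter.Tendsto (fun n => dyadicSum T A n s t) Filter.atTop (nhds (J (s, t))) :=
    fun s t hs hst ht => hJ (s, t) ⟨hs, hst, ht⟩
  refine ⟨fun s t => J (s, t), ?_, ?_, ?_⟩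
  · have hu : TendstoUniformlyOn (fun n x => dyadicSum T A n x.1 x.2) J Filter.atTop
        (Triangle T) := by
      refine Metric.tendstoUniformlyOn_iff.2 fun ε hε => ?_
      obtain ⟨N, hN⟩ := hgrid (ε / 2) (by positivity)
      filter_upwards [Filter.eventually_ge_atTop N] with n hn x hx
      rw [dist_eq_norm]
      have h₁ : Filter.Tendsto (fun M => ‖dyadicSum T A (n + M) x.1 x.2 - dyadicSum T A n x.1 x.2‖)
          Filter.atTop (nhds ‖J x - dyadicSum T A n x.1 x.2‖) := by
        refine (Filter.Tendsto.sub_const ?_ _).norm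
        have := (Filter.tendsto_add_atTop_iff_nat n).2 (hJ x hx)
        simpa only [add_comm] using this
      refine (le_of_tendsto' h₁ fun M => (hN n hn).1 M _ _ hx.1 hx.2.1 hx.2.2).trans_lt ?_
      linarith
    exact hu.continuousOn (Filter.Frequently.of_forall fun n =>
      (continuous_dyadicSum T hcont n).continuousOn)
  · intro s r t hs hsr hrt ht
    have h₁ : Filter.Tendsto (fun n => ‖additiveDefect (dyadicSum T A n) s r t‖) Filter.atTop
        (nhds ‖additiveDefect (fun s t => J (s, t)) s r t‖) :=
      (((hI s t hs (hsr.trans hrt) ht).sub (hI s r hs hsr (hrt.trans ht))).sub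
        (hI r t (hs.trans hsr) hrt ht)).norm
    rw [← norm_le_zero_iff]
    refine le_of_forall_pos_le_add fun ε hε => ?_
    obtain ⟨N, hN⟩ := hgrid ε hε
    rw [zero_add]
    refine le_of_tendsto h₁ ?_
    filter_upwards [Filter.eventually_ge_atTop N] with n hn
    exact (hN n hn).2 s r t hs hsr hrt ht
  · intro s t hs hst ht
    refine le_of_tendsto' ((hI s t hs hst ht).sub_const (A s t)).norm fun n => ?_
    -- The final estimate uses the original defect bound, so the exponent `θ` is not lost to the
    -- interpolation.
    exact norm_sum_sub_le hω hD hθ₀ hθ (fun a b c _ h₂ h₃ _ => hA a b c h₂ h₃) (by positivity)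
      (monotone_clampedGrid hT n) (clampedGrid_zero hs hst n) (clampedGrid_last hst ht n)

end Sewing

/-! ### Factorially decaying bounds -/

/-- The bound `x^{k/p} / (β (k!)^{1/p} k²)` for the level `k` of a multiplicative functional. -/
noncomputable def levelBound (p β : ℝ) (k : ℕ) (x : ℝ) : ℝ :=
  (x ^ k / k.factorial) ^ (1 / p) / (β * (k : ℝ) ^ 2)

section LevelBound

variable {p β : ℝ}

theorem levelBound_nonneg (hβ : 0 ≤ β) (k : ℕ) {x : ℝ} (hx : 0 ≤ x) : 0 ≤ levelBound p β k x := by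
  unfold levelBound
  positivity

theorem levelBound_mono (hp : 0 ≤ p) (hβ : 0 ≤ β) (k : ℕ) {x y : ℝ} (hx : 0 ≤ x) (hxy : x ≤ y) :
    levelBound p β k x ≤ levelBound p β k y := by
  unfold levelBound
  gcongr

theorem levelBound_eq (k : ℕ) {x : ℝ} (hx : 0 ≤ x) :
    levelBound p β k x = levelBound p β k 1 * x ^ ((k : ℝ) / p) := by
  have h : x ^ ((k : ℝ) / p) = (x ^ k) ^ (1 / p) := by
    rw [← Real.rpow_natCast, ← Real.rpow_mul hx, mul_one_div]
  rw [levelBound, levelBound, h, one_pow, Real.div_rpow (by positivity) (by positivity),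
    Real.div_rpow (by positivity) (by positivity), Real.one_rpow]
  ring

theorem levelBound_zero (hp : 0 < p) {k : ℕ} (hk : k ≠ 0) : levelBound p β k 0 = 0 := by
  rw [levelBound, zero_pow hk, zero_div, Real.zero_rpow (by positivity), zero_div]

/-- A single term of the binomial expansion is at most the whole. -/
theorem pow_mul_pow_div_factorial_le {a b : ℝ} (ha : 0 ≤ a) (hb : 0 ≤ b) (k j : ℕ) :
    (a ^ k / k.factorial) * (b ^ j / j.factorial) ≤ (a + b) ^ (k + j) / (k + j).factorial := by
  have h : a ^ k * b ^ j * ((k + j).choose k : ℝ) ≤ (a + b) ^ (k + j) := by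
    rw [add_pow]
    have := Finset.single_le_sum
      (f := fun i => a ^ i * b ^ (k + j - i) * ((k + j).choose i : ℝ))
      (fun i _ => by positivity) (Finset.mem_range.2 (by omega : k < k + j + 1))
    simpa using this
  rw [Nat.cast_add_choose ℝ] at h
  rw [le_div_iff₀ (by positivity)]
  refine le_trans (le_of_eq ?_) h
  field_simp

theorem sum_inv_sq_le (n : ℕ) : ∑ k ∈ Finset.range n, 1 / ((k : ℝ) + 1) ^ 2 ≤ 2 := by
  -- The subtracted term makes the induction telescope.
  suffices h : ∑ k ∈ Finset.range (n + 1), 1 / ((k : ℝ) + 1) ^ 2 ≤ 2 - 1 / ((n : ℝ) + 1) by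
    rw [Finset.sum_range_succ] at h
    have h₁ : 0 ≤ 1 / ((n : ℝ) + 1) := by positivity
    have h₂ : 0 ≤ 1 / ((n : ℝ) + 1) ^ 2 := by positivity
    linarith
  induction n with
  | zero => norm_num
  | succ n ih =>
    rw [Finset.sum_range_succ]
    have h : 1 / (((n + 1 : ℕ) : ℝ) + 1) ^ 2 ≤ 1 / ((n : ℝ) + 1) - 1 / (((n + 1 : ℕ) : ℝ) + 1) := by
      push_cast
      have hx : (0 : ℝ) < (n : ℝ) + 1 := by positivity
      generalize (n : ℝ) + 1 = x at *
      rw [div_sub_div _ _ hx.ne' (by positivity), div_le_div_iff₀ (by positivity) (by positivity)]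
      nlinarith
    linarith

/-- With `x = k + 1` and `y = n - k`, one has `x + y = n + 1` and `1/(x²y²) ≤ 2/(x+y)² · (1/x² +
1/y²)`. Both resulting sums are at most `2`, hence the `8`. -/
theorem sum_inv_sq_mul_inv_sq_le (n : ℕ) :
    ∑ k ∈ Finset.range n, 1 / (((k + 1 : ℕ) : ℝ) ^ 2 * ((n - k : ℕ) : ℝ) ^ 2) ≤
      8 / ((n + 1 : ℕ) : ℝ) ^ 2 := by
  have hterm : ∀ k ∈ Finset.range n, 1 / (((k + 1 : ℕ) : ℝ) ^ 2 * ((n - k : ℕ) : ℝ) ^ 2) ≤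
      2 / ((n + 1 : ℕ) : ℝ) ^ 2 *
        (1 / ((k : ℝ) + 1) ^ 2 + 1 / (((n - 1 - k : ℕ) : ℝ) + 1) ^ 2) := by
    intro k hk
    obtain ⟨j, rfl⟩ : ∃ j, n = k + (j + 1) := ⟨n - k - 1, by
      have := Finset.mem_range.1 hk
      omega⟩
    rw [show k + (j + 1) - k = j + 1 by omega, show k + (j + 1) - 1 - k = j by omega]
    push_cast
    have hx : (0 : ℝ) < k + 1 := by positivity
    have hy : (0 : ℝ) < j + 1 := by positivity
    rw [show (k : ℝ) + (j + 1) + 1 = (k + 1) + (j + 1) by ring]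
    generalize (k : ℝ) + 1 = x at *
    generalize (j : ℝ) + 1 = y at *
    rw [div_add_div _ _ (by positivity) (by positivity), div_mul_div_comm,
      div_le_div_iff₀ (by positivity) (by positivity)]
    have : (x + y) ^ 2 ≤ 2 * (y ^ 2 + x ^ 2) := by nlinarith [sq_nonneg (x - y)]
    have h2 : 0 ≤ x ^ 2 * y ^ 2 := by positivity
    nlinarith [mul_le_mul_of_nonneg_right this h2]
  refine (Finset.sum_le_sum hterm).trans ?_
  rw [← Finset.mul_sum, Finset.sum_add_distrib,
    Finset.sum_range_reflect (fun k => 1 / ((k : ℝ) + 1) ^ 2) n]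
  have := sum_inv_sq_le n
  have h₀ : 0 ≤ 2 / ((n + 1 : ℕ) : ℝ) ^ 2 := by positivity
  refine (mul_le_mul_of_nonneg_left (add_le_add this this) h₀).trans_eq ?_
  ring

/-- A substitute for the neo-classical inequality. -/
theorem sum_levelBound_mul_le (hp : 0 ≤ p) (hβ : 0 < β) (n : ℕ) {a b : ℝ} (ha : 0 ≤ a)
    (hb : 0 ≤ b) :
    ∑ k ∈ Finset.range n, levelBound p β (k + 1) a * levelBound p β (n - k) b ≤
      8 / β * levelBound p β (n + 1) (a + b) := by
  set Q := ((a + b) ^ (n + 1) / (n + 1).factorial) ^ (1 / p) with hQ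
  have hQ₀ : 0 ≤ Q := by positivity
  have hterm : ∀ k ∈ Finset.range n, levelBound p β (k + 1) a * levelBound p β (n - k) b ≤
      Q / β ^ 2 * (1 / (((k + 1 : ℕ) : ℝ) ^ 2 * ((n - k : ℕ) : ℝ) ^ 2)) := by
    intro k hk
    have hkn : k + 1 + (n - k) = n + 1 := by
      have := Finset.mem_range.1 hk
      omega
    -- After taking the power `1 / p`, this bound is the same `Q` for all `k`, so only the
    -- inverse-square weights remain to be summed.
    have h := pow_mul_pow_div_factorial_le ha hb (k + 1) (n - k)
    rw [hkn] at h
    have h' := Real.rpow_le_rpow (by positivity) h (by positivity : 0 ≤ 1 / p)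
    rw [Real.mul_rpow (by positivity) (by positivity), ← hQ] at h'
    rw [levelBound, levelBound, div_mul_div_comm, div_mul_div_comm, mul_one]
    refine (div_le_div_of_nonneg_right h' (by positivity)).trans_eq ?_
    congr 1
    ring
  refine (Finset.sum_le_sum hterm).trans ?_
  rw [← Finset.mul_sum]
  refine (mul_le_mul_of_nonneg_left (sum_inv_sq_mul_inv_sq_le n) (by positivity)).trans_eq ?_
  rw [levelBound, ← hQ]
  field_simp

/-- For large `L`, the trivial bound `x^{k/p}` is below `levelBound p β k (L x)`. -/
theorem rpow_le_levelBound (hp : 0 < p) (hβ : 1 ≤ β) {k q : ℕ} (hk : 1 ≤ k) (hkq : k ≤ q)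
    (hp1 : 1 ≤ p) {x : ℝ} (hx : 0 ≤ x) :
    x ^ ((k : ℝ) / p) ≤ levelBound p β k ((β * q.factorial * (q : ℝ) ^ 2) ^ p * x) := by
  -- `B` dominates the denominator `β (k!)^{1/p} k²` for all `k ≤ q`; scaling by `B ^ p` contributes
  -- the factor `B ^ k ≥ B`.
  set B := β * q.factorial * (q : ℝ) ^ 2 with hB
  have hk' : (1 : ℝ) ≤ k := by exact_mod_cast hk
  have hkq' : (k : ℝ) ≤ q := by exact_mod_cast hkq
  have hq : (1 : ℝ) ≤ q := hk'.trans hkq'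
  have hf : (1 : ℝ) ≤ k.factorial := by exact_mod_cast k.factorial_pos
  have hf' : (k.factorial : ℝ) ≤ q.factorial := by exact_mod_cast Nat.factorial_le hkq
  have hB₀ : 0 < B := by positivity
  have hB₁ : β * k.factorial * (k : ℝ) ^ 2 ≤ B := by
    rw [hB]
    gcongr
  have hB₂ : 1 ≤ B := by
    have h₁ : 1 ≤ β * k.factorial := one_le_mul_of_one_le_of_one_le hβ hf
    exact (one_le_mul_of_one_le_of_one_le h₁ (one_le_pow₀ hk')).trans hB₁
  have hLx : 0 ≤ B ^ p * x := by positivity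
  rw [levelBound_eq k hLx, Real.mul_rpow (by positivity) hx, ← mul_assoc]
  refine le_mul_of_one_le_left (by positivity) ?_
  rw [← Real.rpow_mul hB₀.le, mul_div_cancel₀ _ hp.ne', Real.rpow_natCast, levelBound, one_pow,
    div_mul_eq_mul_div, one_le_div (by positivity), Real.div_rpow (by norm_num) (by positivity),
    Real.one_rpow, div_mul_eq_mul_div, one_mul, le_div_iff₀ (by positivity)]
  have h₁ : (k.factorial : ℝ) ^ (1 / p) ≤ k.factorial := by
    refine (Real.rpow_le_rpow_of_exponent_le hf ?_).trans_eq (Real.rpow_one _)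
    rw [div_le_one hp]
    exact hp1
  calc β * (k : ℝ) ^ 2 * (k.factorial : ℝ) ^ (1 / p) ≤ β * (k : ℝ) ^ 2 * k.factorial := by gcongr
    _ = β * k.factorial * (k : ℝ) ^ 2 := by ring
    _ ≤ B := hB₁
    _ ≤ B ^ k := le_self_pow₀ hB₂ (by omega)

/-- Log-convexity of `Γ`: `n/p + 1` is the convex combination of `n + 1` and `1` with weights `1/p`
and `1 - 1/p`. The case `p = 1` is separate because both weights must be positive. -/
theorem Gamma_div_add_one_le (hp : 1 ≤ p) (n : ℕ) :
    Real.Gamma (1 / p * n + 1) ≤ (n.factorial : ℝ) ^ (1 / p) := by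
  rcases hp.eq_or_lt with rfl | hp
  · simp [Real.Gamma_nat_eq_factorial]
  have hp₀ : 0 < p := by linarith
  have h := Real.Gamma_mul_add_mul_le_rpow_Gamma_mul_rpow_Gamma (s := (n : ℝ) + 1) (t := 1)
    (a := 1 / p) (b := 1 - 1 / p) (by positivity) one_pos (by positivity)
    (by rw [sub_pos, div_lt_one hp₀]; exact hp) (by ring)
  rw [Real.Gamma_one, Real.one_rpow, mul_one, mul_one, Real.Gamma_nat_eq_factorial] at h
  convert h using 2
  ring

theorem levelBound_le_div_Gamma (hp : 1 ≤ p) (hβ : 1 ≤ β) {n : ℕ} (hn : 1 ≤ n) {x : ℝ}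
    (hx : 0 ≤ x) :
    levelBound p β n x ≤ (x ^ (1 / p)) ^ n / Real.Gamma (1 / p * n + 1) := by
  have hn' : (1 : ℝ) ≤ n := by exact_mod_cast hn
  have hG : 0 < Real.Gamma (1 / p * n + 1) := Real.Gamma_pos_of_pos (by positivity)
  rw [levelBound, Real.div_rpow (by positivity) (by positivity), ← Real.rpow_natCast x,
    ← Real.rpow_natCast (x ^ (1 / p)), ← Real.rpow_mul hx, ← Real.rpow_mul hx, mul_comm (n : ℝ),
    div_div]
  refine div_le_div_of_nonneg_left (by positivity) hG ?_
  refine (Gamma_div_add_one_le hp n).trans (le_mul_of_one_le_right (by positivity) ?_)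
  exact one_le_mul_of_one_le_of_one_le hβ (one_le_pow₀ hn')

end LevelBound

/-! ### The Mittag-Leffler series -/

/-- Comparison with the integer part of `x` reduces this to one term of the exponential series; `x ≥
1` keeps the arguments in `[2, ∞)`, where `Γ` increases. -/
theorem rpow_div_Gamma_le {B x : ℝ} (hB : 1 ≤ B) (hx : 1 ≤ x) :
    B ^ x / Real.Gamma (x + 1) ≤ B * Real.exp B := by
  have hj : 1 ≤ ⌊x⌋₊ := Nat.le_floor (by simpa using hx)
  have hj' : (1 : ℝ) ≤ ⌊x⌋₊ := by exact_mod_cast hj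
  have hle := Nat.floor_le (by linarith : 0 ≤ x)
  have hlt := (Nat.lt_floor_add_one x).le
  have hG : ((⌊x⌋₊).factorial : ℝ) ≤ Real.Gamma (x + 1) := by
    rw [← Real.Gamma_nat_eq_factorial]
    exact Real.Gamma_strictMonoOn_Ici.monotoneOn (by simp only [Set.mem_Ici]; linarith)
      (by simp only [Set.mem_Ici]; linarith) (by linarith)
  calc B ^ x / Real.Gamma (x + 1) ≤ B ^ ((⌊x⌋₊ : ℝ) + 1) / (⌊x⌋₊).factorial := by gcongr
    _ = B * (B ^ ⌊x⌋₊ / (⌊x⌋₊).factorial) := by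
      rw [Real.rpow_add_one (by positivity), Real.rpow_natCast]
      ring
    _ ≤ B * Real.exp B := by
      gcongr
      exact Real.pow_div_factorial_le_exp B (by linarith) _

theorem summable_mittagLeffler {p z : ℝ} (hp : 1 ≤ p) (hz : 0 ≤ z) :
    Summable fun n : ℕ => z ^ n / Real.Gamma (1 / p * n + 0 + 1) := by
  have hp₀ : 0 < p := by linarith
  -- The factor `2` leaves a geometric factor `(1/2)^n`, once `b ^ n = (b ^ p) ^ (n / p)` is
  -- controlled by `Γ`.
  set b := 2 * max z 1 with hb
  have hb₁ : 1 ≤ b := by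
    have := le_max_right z 1
    linarith
  have hzb : z ≤ b / 2 := by
    have := le_max_left z 1
    linarith
  have hB : 1 ≤ b ^ p := Real.one_le_rpow hb₁ hp₀.le
  have hg : Summable fun n : ℕ => b ^ p * Real.exp (b ^ p) * (1 / 2 : ℝ) ^ n :=
    (summable_geometric_of_lt_one (by norm_num) (by norm_num)).mul_left _
  refine hg.of_norm_bounded_eventually_nat ?_
  filter_upwards [Filter.eventually_ge_atTop ⌈p⌉₊] with n hn
  have hx : 1 ≤ 1 / p * n := by
    rw [div_mul_eq_mul_div, one_mul, one_le_div hp₀]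
    exact (Nat.le_ceil p).trans (by exact_mod_cast hn)
  have hG : 0 < Real.Gamma (1 / p * n + 1) := Real.Gamma_pos_of_pos (by linarith)
  rw [add_zero, Real.norm_of_nonneg (by positivity)]
  have h := rpow_div_Gamma_le hB hx
  rw [← Real.rpow_mul (by positivity), ← mul_assoc, mul_one_div_cancel hp₀.ne', one_mul,
    Real.rpow_natCast] at h
  calc z ^ n / Real.Gamma (1 / p * n + 1) ≤ (b / 2) ^ n / Real.Gamma (1 / p * n + 1) := by gcongr
    _ = b ^ n / Real.Gamma (1 / p * n + 1) * (1 / 2 : ℝ) ^ n := by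
      rw [div_pow, div_pow, one_pow]
      ring
    _ ≤ _ := mul_le_mul_of_nonneg_right h (by positivity)

/-! ### The simplex -/

section Simplex

variable {T : ℝ}

/-- The retraction of the plane onto the simplex. -/
noncomputable def retract (hT : 0 ≤ T) (s t : ℝ) : Triangle T :=
  ⟨(Set.projIcc 0 T hT s, Set.projIcc 0 T hT (max s t)),
    (Set.projIcc 0 T hT s).2.1, Set.monotone_projIcc hT (le_max_left s t),
    (Set.projIcc 0 T hT (max s t)).2.2⟩

theorem continuous_retract (hT : 0 ≤ T) : Continuous fun x : ℝ × ℝ => retract hT x.1 x.2 := by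
  refine Continuous.subtype_mk ?_ _
  exact (continuous_subtype_val.comp (continuous_projIcc.comp continuous_fst)).prodMk
    (continuous_subtype_val.comp (continuous_projIcc.comp (continuous_fst.max continuous_snd)))

theorem retract_val (hT : 0 ≤ T) {s t : ℝ} (hst : s ≤ t) :
    (retract hT s t).1 = ((Set.projIcc 0 T hT s : ℝ), (Set.projIcc 0 T hT t : ℝ)) := by
  simp only [retract, max_eq_right hst]

theorem retract_of_le (hT : 0 ≤ T) {s t : ℝ} (hs : 0 ≤ s) (hst : s ≤ t) (ht : t ≤ T) :
    retract hT s t = ⟨(s, t), hs, hst, ht⟩ := by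
  refine Subtype.ext ?_
  rw [retract_val hT hst, Set.projIcc_of_mem hT ⟨hs, hst.trans ht⟩,
    Set.projIcc_of_mem hT ⟨hs.trans hst, ht⟩]

theorem retract_self (hT : 0 ≤ T) (st : Triangle T) : retract hT st.1.1 st.1.2 = st :=
  retract_of_le hT st.2.1 st.2.2.1 st.2.2.2

instance compactSpace_triangle (T : ℝ) : CompactSpace (Triangle T) := by
  refine isCompact_iff_compactSpace.1 ?_
  refine IsCompact.of_isClosed_subset (isCompact_Icc (a := ((0 : ℝ), (0 : ℝ))) (b := (T, T))) ?_ ?_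
  · exact (isClosed_le continuous_const continuous_fst).inter
      ((isClosed_le continuous_fst continuous_snd).inter
        (isClosed_le continuous_snd continuous_const))
  · rintro ⟨s, t⟩ ⟨hs, hst, ht⟩
    exact ⟨⟨hs, hs.trans hst⟩, ⟨hst.trans ht, ht⟩⟩

/-- A continuous function on the simplex that vanishes on the diagonal is small near it. -/
theorem exists_forall_norm_retract_le {E : Type*} [NormedAddCommGroup E] (hT : 0 ≤ T)
    {f : Triangle T → E} (hf : Continuous f) (h₀ : ∀ s, f (retract hT s s) = 0) {ε : ℝ}
    (hε : 0 < ε) : ∃ δ > 0, ∀ s t, s ≤ t → t - s ≤ δ → ‖f (retract hT s t)‖ ≤ ε := by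
  obtain ⟨δ, hδ, h⟩ := Metric.uniformContinuous_iff.1
    (CompactSpace.uniformContinuous_of_continuous hf) ε hε
  refine ⟨δ / 2, by positivity, fun s t hst hd => ?_⟩
  have hdist : dist (retract hT s t) (retract hT s s) < δ := by
    rw [Subtype.dist_eq, retract_val hT hst, retract_val hT le_rfl, Prod.dist_eq, dist_self,
      max_eq_right dist_nonneg, Set.coe_projIcc, Set.coe_projIcc, Real.dist_eq]
    refine lt_of_le_of_lt ?_ (by linarith : t - s < δ)
    rw [abs_of_nonneg (sub_nonneg.2 (max_le_max le_rfl (min_le_min le_rfl hst)))]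
    grind
  have := h hdist
  rw [h₀, dist_zero_right] at this
  exact this.le

end Simplex

/-! ### Partitions and variation -/

namespace IntervalPartition

variable {s t : ℝ}

/-- The partition points as a sequence, constant after the last one. -/
def seq (P : IntervalPartition s t) (j : ℕ) : ℝ := P.pt ⟨min j P.m, by omega⟩

theorem monotone_seq (P : IntervalPartition s t) : Monotone P.seq := fun i j h =>
  P.mono (by simp only [Fin.mk_le_mk]; omega)

theorem seq_zero (P : IntervalPartition s t) : P.seq 0 = s := by
  refine Eq.trans (congrArg P.pt (Fin.ext ?_)) P.first
  simp

theorem seq_last (P : IntervalPartition s t) : P.seq P.m = t := by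
  refine Eq.trans (congrArg P.pt (Fin.ext ?_)) P.last
  simp

/-- The partition given by the first points of a monotone sequence. -/
def ofSeq {τ : ℕ → ℝ} (hτ : Monotone τ) (m : ℕ) (h₀ : τ 0 = s) (hm : τ m = t) :
    IntervalPartition s t where
  m := m
  pt i := τ i
  mono _ _ h := hτ h
  first := h₀
  last := hm

end IntervalPartition

/-- The concatenation of two sequences at the index `m`. -/
def concatSeq (τ σ : ℕ → ℝ) (m i : ℕ) : ℝ := if i ≤ m then τ i else σ (i - m)

theorem concatSeq_of_le (τ σ : ℕ → ℝ) {m i : ℕ} (h : i ≤ m) : concatSeq τ σ m i = τ i := if_pos h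

theorem concatSeq_add {τ σ : ℕ → ℝ} {m : ℕ} (h : τ m = σ 0) (i : ℕ) :
    concatSeq τ σ m (m + i) = σ i := by
  rcases Nat.eq_zero_or_pos i with rfl | hi
  · rw [add_zero, concatSeq_of_le _ _ le_rfl, h]
  · rw [concatSeq, if_neg (by omega), Nat.add_sub_cancel_left]

theorem monotone_concatSeq {τ σ : ℕ → ℝ} {m : ℕ} (hτ : Monotone τ) (hσ : Monotone σ)
    (h : τ m = σ 0) : Monotone (concatSeq τ σ m) := by
  intro i j hij
  unfold concatSeq
  split_ifs with h₁ h₂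
  · exact hτ hij
  · exact (hτ h₁).trans (h.le.trans (hσ (Nat.zero_le _)))
  · omega
  · exact hσ (by omega)

section Variation

variable {𝕜 : Type v} [RCLike 𝕜] {H : Type u} [NormedAddCommGroup H] [InnerProductSpace 𝕜 H]
  {T : ℝ}

/-- The variation sum of the level `i` along a sequence of times. -/
noncomputable def variationSum (hT : 0 ≤ T) (p : ℝ) (X : Triangle T → ExtTensorAlgebra 𝕜 H) (i : ℕ)
    (τ : ℕ → ℝ) (m : ℕ) : ℝ≥0∞ :=
  ∑ j ∈ Finset.range m, ‖X (retract hT (τ j) (τ (j + 1))) i‖ₑ ^ (p / i)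

theorem sum_piece_eq_variationSum (hT : 0 ≤ T) (p : ℝ) (X : Triangle T → ExtTensorAlgebra 𝕜 H)
    (i : ℕ) {st : Triangle T} (P : IntervalPartition st.1.1 st.1.2) :
    ∑ k, ‖X (P.piece k) i‖ₑ ^ (p / i) = variationSum hT p X i P.seq P.m := by
  rw [variationSum,
    Finset.sum_range fun j => ‖X (retract hT (P.seq j) (P.seq (j + 1))) i‖ₑ ^ (p / i)]
  refine Finset.sum_congr rfl fun k _ => ?_
  have : P.piece k = retract hT (P.seq k) (P.seq (k + 1)) := by
    rw [← retract_self hT (P.piece k)]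
    have h₁ : (P.piece k).1.1 = P.seq k := by
      refine congrArg P.pt (Fin.ext ?_)
      simp only [Fin.val_castSucc]
      omega
    have h₂ : (P.piece k).1.2 = P.seq (k + 1) := by
      refine congrArg P.pt (Fin.ext ?_)
      simp only [Fin.val_succ]
      omega
    rw [h₁, h₂]
  rw [this]

theorem variationSum_le_levelVariation (hT : 0 ≤ T) (p : ℝ) (X : Triangle T → ExtTensorAlgebra 𝕜 H)
    (i : ℕ) (st : Triangle T) {τ : ℕ → ℝ} (hτ : Monotone τ) {m : ℕ} (h₀ : τ 0 = st.1.1)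
    (hm : τ m = st.1.2) : variationSum hT p X i τ m ≤ levelVariation p X i st := by
  refine le_trans (le_of_eq ?_) (le_iSup (fun P : IntervalPartition st.1.1 st.1.2 =>
    ∑ k, ‖X (P.piece k) i‖ₑ ^ (p / i)) (IntervalPartition.ofSeq hτ m h₀ hm))
  rw [sum_piece_eq_variationSum hT]
  refine Finset.sum_congr rfl fun j hj => ?_
  have hjm : j < m := Finset.mem_range.1 hj
  simp only [IntervalPartition.seq, IntervalPartition.ofSeq]
  rw [min_eq_left hjm.le, min_eq_left (by omega : j + 1 ≤ m)]

theorem levelVariation_le (hT : 0 ≤ T) {p : ℝ} {X : Triangle T → ExtTensorAlgebra 𝕜 H} {i : ℕ}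
    {st : Triangle T} {c : ℝ≥0∞}
    (h : ∀ (τ : ℕ → ℝ) (m : ℕ), Monotone τ → τ 0 = st.1.1 → τ m = st.1.2 →
      variationSum hT p X i τ m ≤ c) : levelVariation p X i st ≤ c :=
  iSup_le fun P => by
    rw [sum_piece_eq_variationSum hT]
    exact h P.seq P.m P.monotone_seq P.seq_zero P.seq_last

theorem variationSum_concatSeq (hT : 0 ≤ T) (p : ℝ) (X : Triangle T → ExtTensorAlgebra 𝕜 H)
    (i : ℕ) {τ σ : ℕ → ℝ} {m : ℕ} (h : τ m = σ 0) (k : ℕ) :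
    variationSum hT p X i (concatSeq τ σ m) (m + k) =
      variationSum hT p X i τ m + variationSum hT p X i σ k := by
  rw [variationSum, Finset.sum_range_add]
  congr 1
  · refine Finset.sum_congr rfl fun j hj => ?_
    have : j < m := Finset.mem_range.1 hj
    rw [concatSeq_of_le _ _ this.le, concatSeq_of_le _ _ this]
  · refine Finset.sum_congr rfl fun j _ => ?_
    rw [add_assoc, concatSeq_add h, concatSeq_add h]

/-- Partitions of two adjacent intervals concatenate. This is the superadditivity behind the control
of a rough path. -/
theorem levelVariation_add_le (hT : 0 ≤ T) (p : ℝ) (X : Triangle T → ExtTensorAlgebra 𝕜 H) (i : ℕ)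
    {s r t : ℝ} (hsr : s ≤ r) (hrt : r ≤ t) :
    levelVariation p X i (retract hT s r) + levelVariation p X i (retract hT r t) ≤
      levelVariation p X i (retract hT s t) := by
  have e₁ := retract_val hT hsr
  have e₂ := retract_val hT hrt
  have e₃ := retract_val hT (hsr.trans hrt)
  -- Merging the two suprema needs nonempty index types; the one-interval partition provides them.
  have hne : ∀ x : Triangle T, Nonempty (IntervalPartition x.1.1 x.1.2) := fun x =>
    ⟨IntervalPartition.ofSeq (τ := fun j => if j = 0 then x.1.1 else x.1.2) (by
      intro a b hab
      have := x.2.2.1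
      dsimp only
      split_ifs <;> first | rfl | assumption | omega) 1 (by simp) (by simp)⟩
  have := hne (retract hT s r)
  have := hne (retract hT r t)
  refine ENNReal.iSup_add_iSup_le fun P Q => ?_
  have hPQ : P.seq P.m = Q.seq 0 := by rw [P.seq_last, Q.seq_zero, e₁, e₂]
  rw [sum_piece_eq_variationSum hT, sum_piece_eq_variationSum hT,
    ← variationSum_concatSeq hT p X i hPQ]
  refine variationSum_le_levelVariation hT p X i _
    (monotone_concatSeq P.monotone_seq Q.monotone_seq hPQ) ?_ ?_
  · rw [concatSeq_of_le _ _ (Nat.zero_le _), P.seq_zero, e₁, e₃]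
  · rw [concatSeq_add hPQ, Q.seq_last, e₂, e₃]

theorem enorm_rpow_eq {E : Type*} [NormedAddCommGroup E] (x : E) {q : ℝ} (hq : 0 ≤ q) :
    ‖x‖ₑ ^ q = ENNReal.ofReal (‖x‖ ^ q) := by
  rw [← ofReal_norm, ENNReal.ofReal_rpow_of_nonneg (norm_nonneg x) hq]

theorem variationSum_eq_ofReal (hT : 0 ≤ T) {p : ℝ} (hp : 0 ≤ p)
    (X : Triangle T → ExtTensorAlgebra 𝕜 H) (i : ℕ) (τ : ℕ → ℝ) (m : ℕ) :
    variationSum hT p X i τ m =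
      ENNReal.ofReal (∑ j ∈ Finset.range m, ‖X (retract hT (τ j) (τ (j + 1))) i‖ ^ (p / i)) := by
  rw [ENNReal.ofReal_sum_of_nonneg fun j _ => by positivity]
  exact Finset.sum_congr rfl fun j _ => enorm_rpow_eq _ (by positivity)

theorem sum_norm_rpow_le_toReal (hT : 0 ≤ T) {p : ℝ} (hp : 0 ≤ p)
    {X : Triangle T → ExtTensorAlgebra 𝕜 H} {i : ℕ} {st : Triangle T}
    (hfin : levelVariation p X i st ≠ ∞) {τ : ℕ → ℝ} (hτ : Monotone τ) {m : ℕ}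
    (h₀ : τ 0 = st.1.1) (hm : τ m = st.1.2) :
    ∑ j ∈ Finset.range m, ‖X (retract hT (τ j) (τ (j + 1))) i‖ ^ (p / i) ≤
      (levelVariation p X i st).toReal := by
  have h := variationSum_le_levelVariation hT p X i st hτ h₀ hm
  rw [variationSum_eq_ofReal hT hp] at h
  exact (ENNReal.ofReal_le_iff_le_toReal hfin).1 h

theorem norm_rpow_le_toReal (hT : 0 ≤ T) {p : ℝ} (hp : 0 ≤ p)
    {X : Triangle T → ExtTensorAlgebra 𝕜 H} {i : ℕ} {st : Triangle T}
    (hfin : levelVariation p X i st ≠ ∞) :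
    ‖X st i‖ ^ (p / i) ≤ (levelVariation p X i st).toReal := by
  have h := sum_norm_rpow_le_toReal hT hp hfin (m := 1)
    (τ := fun j => if j = 0 then st.1.1 else st.1.2) (by
      intro a b hab
      have := st.2.2.1
      dsimp only
      split_ifs <;> first | rfl | assumption | omega) (by simp) (by simp)
  simpa [retract_self] using h

/-- The power `p / i` turns the bound into a multiple of `ω`, which superadditivity sums over any
partition. -/
theorem levelVariation_ne_top_of_bound (hT : 0 ≤ T) {p : ℝ} (hp : 0 < p) {ω : ℝ → ℝ → ℝ}
    (hω : IsControl ω) {X : Triangle T → ExtTensorAlgebra 𝕜 H} {i : ℕ} (hi : 1 ≤ i) {c : ℝ}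
    (hc : 0 ≤ c) (h : ∀ s t, s ≤ t → ‖X (retract hT s t) i‖ ≤ c * ω s t ^ ((i : ℝ) / p))
    (st : Triangle T) : levelVariation p X i st ≠ ∞ := by
  have hi' : (0 : ℝ) < i := by exact_mod_cast hi
  refine ne_top_of_le_ne_top (ENNReal.ofReal_ne_top (r := c ^ (p / i) * ω st.1.1 st.1.2))
    (levelVariation_le hT fun τ m hτ h₀ hm => ?_)
  rw [variationSum_eq_ofReal hT hp.le]
  refine ENNReal.ofReal_le_ofReal ?_
  calc _ ≤ ∑ j ∈ Finset.range m, c ^ (p / i) * ω (τ j) (τ (j + 1)) := by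
        refine Finset.sum_le_sum fun j _ => ?_
        have hle := hτ j.le_succ
        have hW := hω.nonneg hle
        refine (Real.rpow_le_rpow (norm_nonneg _) (h _ _ hle) (by positivity)).trans_eq ?_
        rw [Real.mul_rpow hc (by positivity), ← Real.rpow_mul hW, div_mul_div_cancel₀ hp.ne',
          div_self hi'.ne', Real.rpow_one]
    _ ≤ _ := by
        rw [← Finset.mul_sum, ← h₀, ← hm]
        exact mul_le_mul_of_nonneg_left (hω.sum_le hτ m) (by positivity)

/-- The control of a rough path: the sum of the variations of its levels. -/
noncomputable def pathControl (hT : 0 ≤ T) (p : ℝ) (X : Triangle T → ExtTensorAlgebra 𝕜 H)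
    (s t : ℝ) : ℝ :=
  ∑ i ∈ Finset.Icc 1 ⌊p⌋₊, (levelVariation p X i (retract hT s t)).toReal

theorem HasFiniteVariation.isControl_pathControl (hT : 0 ≤ T) {p : ℝ}
    {X : Triangle T → ExtTensorAlgebra 𝕜 H} (hX : HasFiniteVariation p (⌊p⌋₊ : ℕ∞) X) :
    IsControl (pathControl hT p X) where
  nonneg _ := Finset.sum_nonneg fun _ _ => ENNReal.toReal_nonneg
  superadd {s r t} hsr hrt := by
    rw [pathControl, pathControl, pathControl, ← Finset.sum_add_distrib]
    refine Finset.sum_le_sum fun i hi => ?_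
    have hi' := Finset.mem_Icc.1 hi
    have hfin := hX i hi'.1 (by exact_mod_cast hi'.2)
    rw [← ENNReal.toReal_add (hfin _) (hfin _)]
    exact ENNReal.toReal_mono (hfin _) (levelVariation_add_le hT p X i hsr hrt)

theorem HasFiniteVariation.norm_le_pathControl (hT : 0 ≤ T) {p : ℝ} (hp : 0 < p)
    {X : Triangle T → ExtTensorAlgebra 𝕜 H} (hX : HasFiniteVariation p (⌊p⌋₊ : ℕ∞) X) {i : ℕ}
    (hi : 1 ≤ i) (hip : i ≤ ⌊p⌋₊) (s t : ℝ) :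
    ‖X (retract hT s t) i‖ ≤ pathControl hT p X s t ^ ((i : ℝ) / p) := by
  have hi' : (0 : ℝ) < i := by exact_mod_cast hi
  have h₁ := norm_rpow_le_toReal hT hp.le (hX i hi (by exact_mod_cast hip) (retract hT s t))
  have h₂ : (levelVariation p X i (retract hT s t)).toReal ≤ pathControl hT p X s t :=
    Finset.single_le_sum (f := fun i => (levelVariation p X i (retract hT s t)).toReal)
      (fun _ _ => ENNReal.toReal_nonneg) (Finset.mem_Icc.2 ⟨hi, hip⟩)
  have h₃ := Real.rpow_le_rpow (by positivity) (h₁.trans h₂) (by positivity : 0 ≤ (i : ℝ) / p)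
  rwa [← Real.rpow_mul (norm_nonneg _), div_mul_div_cancel₀ hi'.ne', div_self hp.ne',
    Real.rpow_one] at h₃

theorem HasFiniteVariation.pathControl_le (hT : 0 ≤ T) {p : ℝ} (hp : 0 < p)
    {X : Triangle T → ExtTensorAlgebra 𝕜 H} (hX : HasFiniteVariation p (⌊p⌋₊ : ℕ∞) X)
    (st : Triangle T) :
    pathControl hT p X st.1.1 st.1.2 ≤ ⌊p⌋₊ * variationNorm p X st ^ p := by
  have hfin : ∀ i ∈ Finset.Icc 1 ⌊p⌋₊, levelVariation p X i st ≠ ∞ := fun i hi =>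
    hX i (Finset.mem_Icc.1 hi).1 (by exact_mod_cast (Finset.mem_Icc.1 hi).2) st
  have hsup : (⨆ i ∈ Finset.Icc 1 ⌊p⌋₊, levelVariation p X i st) ≠ ∞ := by
    refine ne_top_of_le_ne_top (ENNReal.sum_ne_top.2 hfin) ?_
    exact iSup₂_le fun i hi => Finset.single_le_sum (f := fun i => levelVariation p X i st)
      (fun _ _ => zero_le) hi
  rw [variationNorm, ← Real.rpow_mul ENNReal.toReal_nonneg, one_div_mul_cancel hp.ne',
    Real.rpow_one, pathControl, retract_self]
  refine (Finset.sum_le_card_nsmul _ _ _ fun i hi => ENNReal.toReal_mono hsup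
    (le_iSup₂ (f := fun i _ => levelVariation p X i st) i hi)).trans_eq ?_
  simp

theorem variationNorm_nonneg (p : ℝ) (X : Triangle T → ExtTensorAlgebra 𝕜 H) (st : Triangle T) :
    0 ≤ variationNorm p X st :=
  Real.rpow_nonneg ENNReal.toReal_nonneg _

/-- Chen's relation, for the extension to all real times. -/
theorem IsMultiplicativeFunctional.chen_retract (hT : 0 ≤ T) {N : ℕ∞}
    {X : Triangle T → ExtTensorAlgebra 𝕜 H} (hX : IsMultiplicativeFunctional N X) {s r t : ℝ}
    (hsr : s ≤ r) (hrt : r ≤ t) {n : ℕ} (hn : n ≤ N) :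
    X (retract hT s t) n =
      ExtTensorAlgebra.mul (X (retract hT s r)) (X (retract hT r t)) n := by
  have hmono := Set.monotone_projIcc hT
  have key : ∀ {a b : ℝ} (hab : a ≤ b), retract hT a b =
      ⟨((Set.projIcc 0 T hT a : ℝ), (Set.projIcc 0 T hT b : ℝ)), (Set.projIcc 0 T hT a).2.1,
        hmono hab, (Set.projIcc 0 T hT b).2.2⟩ := fun hab => Subtype.ext (retract_val hT hab)
  rw [key hsr, key hrt, key (hsr.trans hrt)]
  exact hX.chen _ _ _ (Set.projIcc 0 T hT s).2.1 (hmono hsr) (hmono hrt)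
    (Set.projIcc 0 T hT t).2.2 n hn

end Variation

/-! ### Extension of multiplicative functionals by one level -/

section Extension

variable {𝕜 : Type v} [RCLike 𝕜] {H : Type u} [NormedAddCommGroup H] [InnerProductSpace 𝕜 H]
  {T : ℝ}

open HilbertTensorPower (one)

namespace ExtTensorAlgebra

theorem mul_succ_eq_midMul {x y : ExtTensorAlgebra 𝕜 H} {n : ℕ} (hx : x 0 = one) (hy : y 0 = one)
    (hx' : x (n + 1) = 0) (hy' : y (n + 1) = 0) : mul x y (n + 1) = midMul x y n := by
  rw [mul_succ_apply hx hy, hx', hy', zero_add, zero_add]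

/-- Associativity of `x ⊗ y ⊗ z` at level `n + 1`, where `w` and `x'` agree with `y ⊗ z` and `x ⊗ y`
up to level `n` but have no level `n + 1`. It is applied to `x = Y_{0,s}`, `y = Y_{s,r}`, `z =
Y_{r,t}`. -/
theorem mul_sub_mul_sub_mul {x y z w x' : ExtTensorAlgebra 𝕜 H} {n : ℕ} (hx : x 0 = one)
    (hy : y 0 = one) (hz : z 0 = one) (hw : w 0 = one) (hx' : x' 0 = one) (hxn : x (n + 1) = 0)
    (hzn : z (n + 1) = 0) (hwn : w (n + 1) = 0) (hx'n : x' (n + 1) = 0)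
    (hwyz : ∀ k ≤ n, w k = mul y z k) (hxy : ∀ k ≤ n, x' k = mul x y k) :
    mul x w (n + 1) - mul x y (n + 1) - mul x' z (n + 1) = -mul y z (n + 1) := by
  have h₁ := congrFun (mul_assoc x y z) (n + 1)
  rw [mul_succ_apply (mul_zero_apply hx hy) hz, mul_succ_apply hx (mul_zero_apply hy hz), hxn, hzn,
    ← midMul_congr hxy fun _ _ => rfl, ← midMul_congr (fun _ _ => rfl) hwyz] at h₁
  rw [mul_succ_eq_midMul hx hw hxn hwn, mul_succ_eq_midMul hx' hz hx'n hzn]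
  rw [zero_add, add_zero] at h₁
  rw [sub_sub, h₁]
  abel

end ExtTensorAlgebra

/-- A multiplicative functional of degree `N` whose levels decay factorially along the control
`ω`. -/
structure HasFactorialDecay (p β : ℝ) (ω : ℝ → ℝ → ℝ) (N : ℕ)
    (Y : Triangle T → ExtTensorAlgebra 𝕜 H) : Prop where
  multiplicative : IsMultiplicativeFunctional (N : ℕ∞) Y
  bound : ∀ k, 1 ≤ k → k ≤ N → ∀ st, ‖Y st k‖ ≤ levelBound p β k (ω st.1.1 st.1.2)

/-- The germ of the level `N + 1` of the extension of a functional of degree `N`. -/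
noncomputable def extensionGerm (hT : 0 ≤ T) (Y : Triangle T → ExtTensorAlgebra 𝕜 H) (N : ℕ)
    (s t : ℝ) : HilbertTensorPower 𝕜 H (N + 1) :=
  ExtTensorAlgebra.mul (Y (retract hT (min 0 s) s)) (Y (retract hT s t)) (N + 1)

namespace IsMultiplicativeFunctional

variable {N : ℕ} {Y : Triangle T → ExtTensorAlgebra 𝕜 H}

theorem apply_succ (hY : IsMultiplicativeFunctional (N : ℕ∞) Y) (st : Triangle T) :
    Y st (N + 1) = 0 :=
  hY.trunc st _ (by exact_mod_cast N.lt_succ_self)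

theorem continuous_extensionGerm (hT : 0 ≤ T) (hY : IsMultiplicativeFunctional (N : ℕ∞) Y) :
    Continuous (Function.uncurry (extensionGerm hT Y N)) := by
  have h : Function.uncurry (extensionGerm hT Y N) = fun x : ℝ × ℝ =>
      ExtTensorAlgebra.midMul (Y (retract hT (min 0 x.1) x.1)) (Y (retract hT x.1 x.2)) N :=
    funext fun x => ExtTensorAlgebra.mul_succ_eq_midMul (hY.zero _) (hY.zero _) (hY.apply_succ _)
      (hY.apply_succ _)
  rw [h]
  have h₁ : Continuous fun x : ℝ × ℝ => Y (retract hT (min 0 x.1) x.1) :=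
    hY.continuous.comp ((continuous_retract hT).comp
      ((continuous_const.min continuous_fst).prodMk continuous_fst))
  exact (ExtTensorAlgebra.continuous_midMul N).comp
    (h₁.prodMk (hY.continuous.comp (continuous_retract hT)))

theorem additiveDefect_extensionGerm (hT : 0 ≤ T) (hY : IsMultiplicativeFunctional (N : ℕ∞) Y)
    {s r t : ℝ} (hsr : s ≤ r) (hrt : r ≤ t) :
    additiveDefect (extensionGerm hT Y N) s r t =
      -ExtTensorAlgebra.mul (Y (retract hT s r)) (Y (retract hT r t)) (N + 1) := by
  -- Both left endpoints project to `0`; the minimum only keeps them ordered before real times that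
  -- may be negative.
  have hbase : retract hT (min 0 r) r = retract hT (min 0 s) r := by
    refine Subtype.ext ?_
    rw [retract_val hT (min_le_right _ _), retract_val hT ((min_le_right _ _).trans hsr),
      Set.projIcc_of_le_left hT (min_le_left _ _), Set.projIcc_of_le_left hT (min_le_left _ _)]
  refine ExtTensorAlgebra.mul_sub_mul_sub_mul (hY.zero _) (hY.zero _) (hY.zero _) (hY.zero _)
    (hY.zero _) (hY.apply_succ _) (hY.apply_succ _) (hY.apply_succ _) (hY.apply_succ _)
    (fun k hk => hY.chen_retract hT hsr hrt (by exact_mod_cast hk)) fun k hk => ?_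
  rw [hbase]
  exact hY.chen_retract hT (min_le_right _ _) hsr (by exact_mod_cast hk)

end IsMultiplicativeFunctional

namespace HasFactorialDecay

variable {p β : ℝ} {ω : ℝ → ℝ → ℝ} {N : ℕ} {Y : Triangle T → ExtTensorAlgebra 𝕜 H}

theorem norm_retract_le (hT : 0 ≤ T) (hY : HasFactorialDecay p β ω N Y)
    (hr : ∀ s t, s ≤ t → ω (retract hT s t).1.1 (retract hT s t).1.2 = ω s t) {k : ℕ} (hk : 1 ≤ k)
    (hkN : k ≤ N) {s t : ℝ} (hst : s ≤ t) :
    ‖Y (retract hT s t) k‖ ≤ levelBound p β k (ω s t) := by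
  rw [← hr s t hst]
  exact hY.bound k hk hkN _

theorem norm_mul_succ_le (hT : 0 ≤ T) (hp : 0 < p) (hβ : 0 < β) (hω : IsControl ω)
    (hr : ∀ s t, s ≤ t → ω (retract hT s t).1.1 (retract hT s t).1.2 = ω s t)
    (hY : HasFactorialDecay p β ω N Y) {s r t : ℝ} (hsr : s ≤ r) (hrt : r ≤ t) :
    ‖ExtTensorAlgebra.mul (Y (retract hT s r)) (Y (retract hT r t)) (N + 1)‖ ≤
      8 / β * levelBound p β (N + 1) (ω s t) := by
  have hm := hY.multiplicative
  rw [ExtTensorAlgebra.mul_succ_eq_midMul (hm.zero _) (hm.zero _) (hm.apply_succ _)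
    (hm.apply_succ _)]
  have h₁ := hω.nonneg hsr
  have h₂ := hω.nonneg hrt
  calc _ ≤ ∑ k ∈ Finset.range N, levelBound p β (k + 1) (ω s r) * levelBound p β (N - k) (ω r t) :=
        (ExtTensorAlgebra.norm_midMul_le _ _ _).trans <| Finset.sum_le_sum fun k hk => by
          have hkN : k < N := Finset.mem_range.1 hk
          exact mul_le_mul (hY.norm_retract_le hT hr (by omega) hkN hsr)
            (hY.norm_retract_le hT hr (by omega) (by omega) hrt) (norm_nonneg _)
            (levelBound_nonneg hβ.le _ h₁)
    _ ≤ 8 / β * levelBound p β (N + 1) (ω s r + ω r t) := sum_levelBound_mul_le hp.le hβ N h₁ h₂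
    _ ≤ _ := by
        have := levelBound_mono hp.le hβ.le (N + 1) (add_nonneg h₁ h₂) (hω.superadd hsr hrt)
        gcongr

/-- The levels `1, …, N` are continuous on a compact simplex and vanish on the diagonal, since
`ω(s,s) = 0`. This provides the smallness that a possibly discontinuous control cannot. -/
theorem exists_norm_mul_succ_le (hT : 0 ≤ T) (hp : 0 < p) (hω : IsControl ω)
    (hr : ∀ s t, s ≤ t → ω (retract hT s t).1.1 (retract hT s t).1.2 = ω s t)
    (hY : HasFactorialDecay p β ω N Y) {ε : ℝ} (hε : 0 < ε) :
    ∃ δ > 0, ∀ s r t, s ≤ r → r ≤ t → t - s ≤ δ →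
      ‖ExtTensorAlgebra.mul (Y (retract hT s r)) (Y (retract hT r t)) (N + 1)‖ ≤ ε := by
  have hm := hY.multiplicative
  let f : Triangle T → ∀ k : Fin N, HilbertTensorPower 𝕜 H (k + 1) := fun st k => Y st (k + 1)
  have hf : Continuous f := continuous_pi fun k => (continuous_apply _).comp hm.continuous
  have hf₀ : ∀ s, f (retract hT s s) = 0 := fun s => funext fun k => by
    have h := hY.norm_retract_le hT hr (k := k + 1) (by omega) (by omega) (le_refl s)
    rw [hω.apply_self, levelBound_zero hp (by omega)] at h
    exact norm_le_zero_iff.1 h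
  have hη : 0 < min 1 (ε / (N + 1)) := by positivity
  obtain ⟨δ, hδ, h⟩ := exists_forall_norm_retract_le hT hf hf₀ hη
  have hlevel : ∀ s t, s ≤ t → t - s ≤ δ → ∀ k, 1 ≤ k → k ≤ N →
      ‖Y (retract hT s t) k‖ ≤ min 1 (ε / (N + 1)) := by
    intro s t hst hd k hk hkN
    obtain ⟨k, rfl⟩ := Nat.exists_eq_succ_of_ne_zero (by omega : k ≠ 0)
    exact (norm_le_pi_norm (f (retract hT s t)) ⟨k, hkN⟩).trans (h s t hst hd)
  refine ⟨δ, hδ, fun s r t hsr hrt hd => ?_⟩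
  rw [ExtTensorAlgebra.mul_succ_eq_midMul (hm.zero _) (hm.zero _) (hm.apply_succ _)
    (hm.apply_succ _)]
  calc _ ≤ ∑ _k ∈ Finset.range N, 1 * (ε / (N + 1)) :=
        (ExtTensorAlgebra.norm_midMul_le _ _ _).trans <| Finset.sum_le_sum fun k hk => by
          have hkN : k < N := Finset.mem_range.1 hk
          exact mul_le_mul
            ((hlevel s r hsr (by linarith) _ (by omega) hkN).trans (min_le_left _ _))
            ((hlevel r t hrt (by linarith) _ (by omega) (by omega)).trans (min_le_right _ _))
            (norm_nonneg _) zero_le_one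
    _ = ε * (N / (N + 1)) := by
        rw [Finset.sum_const, Finset.card_range, nsmul_eq_mul]
        ring
    _ ≤ ε := by
        refine mul_le_of_le_one_right hε.le ?_
        rw [div_le_one (by positivity)]
        linarith

/-- The new level is the sewn additive function minus the germ. Its defect is the opposite of that
of the germ, which is Chen's relation; its size is the sewing error, and `hβK` brings this back
under the same bound with the same `β`, so the step can be iterated. -/
theorem exists_extension (hT : 0 ≤ T) (hp : 1 ≤ p) (hβ : 1 ≤ β)
    (hβK : 8 * sewingConst ((⌊p⌋₊ + 1) / p) ≤ β) (hω : IsControl ω)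
    (hr : ∀ s t, s ≤ t → ω (retract hT s t).1.1 (retract hT s t).1.2 = ω s t)
    (hN : ⌊p⌋₊ ≤ N) (hY : HasFactorialDecay p β ω N Y) :
    ∃ Y' : Triangle T → ExtTensorAlgebra 𝕜 H, HasFactorialDecay p β ω (N + 1) Y' ∧
      ∀ st, ∀ n ≤ N, Y' st n = Y st n := by
  have hp₀ : 0 < p := by linarith
  have hβ₀ : 0 < β := by linarith
  have hm := hY.multiplicative
  set b := levelBound p β (N + 1) 1 with hb
  have hb₀ : 0 ≤ b := levelBound_nonneg hβ₀.le _ zero_le_one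
  have hbound : ∀ x, 0 ≤ x → levelBound p β (N + 1) x = b * x ^ (((N : ℝ) + 1) / p) := by
    intro x hx
    rw [levelBound_eq (N + 1) hx, Nat.cast_add_one]
  -- The exponent of the first new level; later ones are larger, so this one fixes the sewing
  -- constant.
  have hθ₀ : 1 < ((⌊p⌋₊ : ℝ) + 1) / p := by
    rw [one_lt_div hp₀]
    exact Nat.lt_floor_add_one p
  have hθ : ((⌊p⌋₊ : ℝ) + 1) / p ≤ ((N : ℝ) + 1) / p := by
    have : (⌊p⌋₊ : ℝ) ≤ N := by exact_mod_cast hN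
    gcongr
  obtain ⟨I, hIc, hIadd, hIA⟩ := exists_sewing hω (hm.continuous_extensionGerm hT)
    (D := 8 / β * b) (by positivity) hθ₀ hθ
    (fun s r t hsr hrt => by
      rw [hm.additiveDefect_extensionGerm hT hsr hrt, norm_neg, mul_assoc,
        ← hbound _ (hω.nonneg (hsr.trans hrt))]
      exact hY.norm_mul_succ_le hT hp₀ hβ₀ hω hr hsr hrt)
    (fun ε hε => by
      obtain ⟨δ, hδ, h⟩ := hY.exists_norm_mul_succ_le hT hp₀ hω hr hε
      refine ⟨δ, hδ, fun s r t hsr hrt hd => ?_⟩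
      rw [hm.additiveDefect_extensionGerm hT hsr hrt, norm_neg]
      exact h s r t hsr hrt hd) hT
  let Ψ : Triangle T → HilbertTensorPower 𝕜 H (N + 1) := fun st =>
    I st.1.1 st.1.2 - extensionGerm hT Y N st.1.1 st.1.2
  have hΨc : Continuous Ψ :=
    (continuousOn_iff_continuous_domRestrict.1 hIc).sub
      ((hm.continuous_extensionGerm hT).comp continuous_subtype_val)
  let Y' : Triangle T → ExtTensorAlgebra 𝕜 H := fun st => Function.update (Y st) (N + 1) (Ψ st)
  have hle : ∀ st, ∀ n ≤ N, Y' st n = Y st n := fun st n hn =>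
    Function.update_of_ne (by omega) _ _
  have htop : ∀ st, Y' st (N + 1) = Ψ st := fun st => Function.update_self _ _ _
  have h0 : ∀ st, Y' st 0 = one := fun st => (hle st 0 N.zero_le).trans (hm.zero st)
  refine ⟨Y', ⟨⟨hm.continuous.update _ hΨc, h0, fun st n hn => ?_, ?_⟩, fun k hk hkN st => ?_⟩,
    hle⟩
  · have hn' : N + 1 < n := by exact_mod_cast hn
    exact (Function.update_of_ne (by omega) _ _).trans
      (hm.trunc st n (by exact_mod_cast (by omega : N < n)))
  · intro s r t hs hsr hrt ht n hn
    have hn' : n ≤ N + 1 := by exact_mod_cast hn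
    rcases hn'.lt_or_eq with hlt | rfl
    · rw [hle _ n (by omega), hm.chen s r t hs hsr hrt ht n (by exact_mod_cast (by omega : n ≤ N))]
      exact ExtTensorAlgebra.mul_congr (fun k hk => (hle _ k (by omega)).symm)
        fun k hk => (hle _ k (by omega)).symm
    · rw [htop, ExtTensorAlgebra.mul_succ_apply (h0 _) (h0 _), htop, htop,
        ExtTensorAlgebra.midMul_congr (hle _) (hle _),
        ← ExtTensorAlgebra.mul_succ_eq_midMul (hm.zero _) (hm.zero _) (hm.apply_succ _)
          (hm.apply_succ _)]
      have h₁ := hIadd s r t hs hsr hrt ht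
      have h₂ := hm.additiveDefect_extensionGerm hT hsr hrt
      rw [retract_of_le hT hs hsr (hrt.trans ht), retract_of_le hT (hs.trans hsr) hrt ht,
        eq_neg_iff_add_eq_zero, ← neg_eq_iff_add_eq_zero, additiveDefect] at h₂
      rw [← h₂]
      rw [additiveDefect, sub_sub, sub_eq_zero] at h₁
      simp only [Ψ, h₁]
      abel
  · rcases hkN.lt_or_eq with hlt | rfl
    · rw [hle st k (by omega)]
      exact hY.bound k hk (by omega) st
    · have hW := hω.nonneg st.2.2.1
      rw [htop, hbound _ hW]
      refine (hIA _ _ st.2.1 st.2.2.1 st.2.2.2).trans ?_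
      refine mul_le_mul_of_nonneg_right ?_ (by positivity)
      rw [div_mul_eq_mul_div, div_mul_eq_mul_div, div_le_iff₀ hβ₀]
      nlinarith

/-- The extension theorem: a functional with factorial decay extends to all levels. -/
theorem exists_full_extension (hT : 0 ≤ T) (hp : 1 ≤ p) (hβ : 1 ≤ β)
    (hβK : 8 * sewingConst ((⌊p⌋₊ + 1) / p) ≤ β) (hω : IsControl ω)
    (hr : ∀ s t, s ≤ t → ω (retract hT s t).1.1 (retract hT s t).1.2 = ω s t)
    {X : Triangle T → ExtTensorAlgebra 𝕜 H} (hX : HasFactorialDecay p β ω ⌊p⌋₊ X) :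
    ∃ S : Triangle T → ExtTensorAlgebra 𝕜 H, IsMultiplicativeFunctional ⊤ S ∧
      (∀ st, ∀ n ≤ ⌊p⌋₊, S st n = X st n) ∧
      ∀ k, 1 ≤ k → ∀ st, ‖S st k‖ ≤ levelBound p β k (ω st.1.1 st.1.2) := by
  have hstep : ∀ (j : ℕ) (Y : {Y : Triangle T → ExtTensorAlgebra 𝕜 H //
      HasFactorialDecay p β ω (⌊p⌋₊ + j) Y}), ∃ Y' : {Y : Triangle T → ExtTensorAlgebra 𝕜 H //
      HasFactorialDecay p β ω (⌊p⌋₊ + (j + 1)) Y},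
      ∀ st, ∀ n ≤ ⌊p⌋₊ + j, Y'.1 st n = Y.1 st n := by
    rintro j ⟨Y, hY⟩
    obtain ⟨Y', hY', h⟩ := hY.exists_extension hT hp hβ hβK hω hr (Nat.le_add_right _ _)
    exact ⟨⟨Y', hY'⟩, h⟩
  choose g hg using hstep
  let F : ∀ j : ℕ, {Y : Triangle T → ExtTensorAlgebra 𝕜 H //
      HasFactorialDecay p β ω (⌊p⌋₊ + j) Y} := fun j => Nat.rec ⟨X, hX⟩ g j
  have hmono : ∀ i j, i ≤ j → ∀ st, ∀ n ≤ ⌊p⌋₊ + i, (F j).1 st n = (F i).1 st n := by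
    intro i j hij st n hn
    induction j, hij using Nat.le_induction with
    | base => rfl
    | succ j hij ih => exact (hg j (F j) st n (by omega)).trans ih
  have hmult := fun j => (F j).2.multiplicative
  -- Diagonal choice: `F n` has degree `⌊p⌋₊ + n ≥ n`, so its level `n` is already final.
  refine ⟨fun st n => (F n).1 st n, ⟨?_, fun st => (hmult 0).zero st, ?_, ?_⟩, ?_, ?_⟩
  · exact continuous_pi fun n => (continuous_apply n).comp (hmult n).continuous
  · intro st n hn
    exact absurd hn not_top_lt
  · intro s r t hs hsr hrt ht n _
    refine ((hmult n).chen s r t hs hsr hrt ht n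
      (by exact_mod_cast (by omega : n ≤ ⌊p⌋₊ + n))).trans ?_
    exact ExtTensorAlgebra.mul_congr (fun k hk => hmono k n hk _ k (by omega))
      fun k hk => hmono k n hk _ k (by omega)
  · exact fun st n hn => hmono 0 n n.zero_le st n hn
  · exact fun k hk st => (F k).2.bound k hk (by omega) st

end HasFactorialDecay

end Extension

/-! ### Uniqueness of signatures -/

section Uniqueness

variable {T : ℝ}

/-- A continuous additive function of intervals with finite variation of an order less than `1`
vanishes. -/
theorem eq_zero_of_additive_of_sum_rpow_le {E : Type*} [NormedAddCommGroup E] (hT : 0 ≤ T)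
    {f : Triangle T → E} (hf : Continuous f)
    (hadd : ∀ s r t, s ≤ r → r ≤ t → f (retract hT s t) = f (retract hT s r) + f (retract hT r t))
    {q : ℝ} (hq₁ : q < 1) (st : Triangle T) {B : ℝ}
    (hB : ∀ (τ : ℕ → ℝ) (m : ℕ), Monotone τ → τ 0 = st.1.1 → τ m = st.1.2 →
      ∑ j ∈ Finset.range m, ‖f (retract hT (τ j) (τ (j + 1)))‖ ^ q ≤ B) : f st = 0 := by
  have hdiag : ∀ s, f (retract hT s s) = 0 := fun s => by
    simpa using hadd s s s le_rfl le_rfl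
  have hsum : ∀ (τ : ℕ → ℝ), Monotone τ → ∀ m,
      f (retract hT (τ 0) (τ m)) = ∑ j ∈ Finset.range m, f (retract hT (τ j) (τ (j + 1))) := by
    intro τ hτ m
    induction m with
    | zero => simpa using hdiag _
    | succ m ih => rw [Finset.sum_range_succ, ← ih, hadd _ _ _ (hτ m.zero_le) (hτ m.le_succ)]
  have hq : 0 < 1 - q := by linarith
  rw [← norm_le_zero_iff]
  refine le_of_forall_pos_le_add fun η hη => ?_
  rw [zero_add]
  -- On a fine grid each increment satisfies `x = x^{1-q} x^q ≤ η / (|B| + 1) · x^q`, and the sum of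
  -- the `x^q` is at most `B`.
  have hε : 0 < η / (|B| + 1) := by positivity
  obtain ⟨δ, hδ, h⟩ := exists_forall_norm_retract_le hT hf hdiag
    (Real.rpow_pos_of_pos hε (1 - q)⁻¹)
  obtain ⟨N, hN⟩ := exists_div_two_pow_le T hδ
  have hτ : Monotone (clampedGrid T st.1.1 st.1.2 N) := monotone_clampedGrid hT N
  have h₀ := clampedGrid_zero (T := T) st.2.1 st.2.2.1 N
  have h₁ := clampedGrid_last st.2.2.1 st.2.2.2 N
  have key := hsum _ hτ (2 ^ N)
  rw [h₀, h₁, retract_self] at key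
  rw [key]
  calc _ ≤ ∑ j ∈ Finset.range (2 ^ N), η / (|B| + 1) * ‖f (retract hT
        (clampedGrid T st.1.1 st.1.2 N j) (clampedGrid T st.1.1 st.1.2 N (j + 1)))‖ ^ q := by
        refine (norm_sum_le _ _).trans (Finset.sum_le_sum fun j _ => ?_)
        have hx := h _ _ (hτ j.le_succ) ((clampedGrid_succ_sub_le hT N j).trans (hN N le_rfl))
        have hx₀ := norm_nonneg (f (retract hT (clampedGrid T st.1.1 st.1.2 N j)
          (clampedGrid T st.1.1 st.1.2 N (j + 1))))
        generalize ‖f _‖ = x at hx hx₀ ⊢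
        have hsplit : x = x ^ (1 - q) * x ^ q := by
          rw [← Real.rpow_add' hx₀ (by norm_num)]
          norm_num
        have hle := Real.rpow_le_rpow hx₀ hx hq.le
        rw [Real.rpow_inv_rpow hε.le hq.ne'] at hle
        exact hsplit.trans_le (mul_le_mul_of_nonneg_right hle (Real.rpow_nonneg hx₀ _))
    _ ≤ η / (|B| + 1) * |B| := by
        rw [← Finset.mul_sum]
        exact mul_le_mul_of_nonneg_left ((hB _ _ hτ h₀ h₁).trans (le_abs_self B)) hε.le
    _ ≤ η := by
        rw [div_mul_eq_mul_div, div_le_iff₀ (by positivity)]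
        nlinarith

variable {𝕜 : Type v} [RCLike 𝕜] {H : Type u} [NormedAddCommGroup H] [InnerProductSpace 𝕜 H]

/-- Strong induction on the level: once the lower levels agree, the middle terms of Chen's relation
cancel and the difference is additive. Its variation of order `q = p / (m + 1) < 1` is finite
because `x ↦ x^q` is subadditive. -/
theorem IsSignature.unique (hT : 0 ≤ T) {p : ℝ} (hp : 1 ≤ p)
    {X S S' : Triangle T → ExtTensorAlgebra 𝕜 H} (hS : IsSignature p X S)
    (hS' : IsSignature p X S') : S = S' := by
  have hp₀ : 0 < p := by linarith
  suffices h : ∀ n st, S st n = S' st n from funext fun st => funext fun n => h n st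
  intro n
  induction n using Nat.strong_induction_on with
  | _ n ih =>
  intro st
  rcases le_or_gt n ⌊p⌋₊ with hn | hn
  · rw [hS.extends_path st n hn, hS'.extends_path st n hn]
  obtain ⟨m, rfl⟩ := Nat.exists_eq_succ_of_ne_zero (by omega : n ≠ 0)
  have hm := hS.multiplicative
  have hm' := hS'.multiplicative
  have hq : p / ((m + 1 : ℕ) : ℝ) < 1 := by
    rw [div_lt_one (by positivity)]
    exact (Nat.floor_lt hp₀.le).1 hn
  have hq₀ : 0 ≤ p / ((m + 1 : ℕ) : ℝ) := by positivity
  have hfin := hS.finite_variation (m + 1) (by omega) le_top st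
  have hfin' := hS'.finite_variation (m + 1) (by omega) le_top st
  refine sub_eq_zero.1 (eq_zero_of_additive_of_sum_rpow_le hT
    (f := fun st => S st (m + 1) - S' st (m + 1))
    (((continuous_apply _).comp hm.continuous).sub ((continuous_apply _).comp hm'.continuous))
    (fun s r t hsr hrt => ?_) hq st
    (B := (levelVariation p S (m + 1) st).toReal + (levelVariation p S' (m + 1) st).toReal)
    fun τ k hτ h₀ hk => ?_)
  · rw [hm.chen_retract hT hsr hrt le_top, hm'.chen_retract hT hsr hrt le_top,
      ExtTensorAlgebra.mul_succ_apply (hm.zero _) (hm.zero _),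
      ExtTensorAlgebra.mul_succ_apply (hm'.zero _) (hm'.zero _),
      ExtTensorAlgebra.midMul_congr (fun j hj => ih j (by omega) _) fun j hj => ih j (by omega) _]
    abel
  · refine le_trans ?_ (add_le_add (sum_norm_rpow_le_toReal hT hp₀.le hfin hτ h₀ hk)
      (sum_norm_rpow_le_toReal hT hp₀.le hfin' hτ h₀ hk))
    rw [← Finset.sum_add_distrib]
    refine Finset.sum_le_sum fun j _ => ?_
    exact (Real.rpow_le_rpow (norm_nonneg _) (norm_sub_le _ _) hq₀).trans
      (Real.rpow_add_le_add_rpow (norm_nonneg _) (norm_nonneg _) hq₀ hq.le)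

end Uniqueness

/-! ### Existence of signatures and the Fock space bound -/

section Existence

variable {𝕜 : Type v} [RCLike 𝕜] {H : Type u} [NormedAddCommGroup H] [InnerProductSpace 𝕜 H]
  {T : ℝ}

/-- Scaling the control by a constant depending on `p` and `β` makes the given levels satisfy the
factorial bound, which starts the induction. -/
theorem IsRoughPath.exists_signature (hT : 0 ≤ T) {p : ℝ} (hp : 1 ≤ p) {β : ℝ} (hβ : 1 ≤ β)
    (hβK : 8 * sewingConst ((⌊p⌋₊ + 1) / p) ≤ β)
    {X : Triangle T → ExtTensorAlgebra 𝕜 H} (hX : IsRoughPath p X) :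
    ∃ S : Triangle T → ExtTensorAlgebra 𝕜 H, IsSignature p X S ∧
      ∀ k, 1 ≤ k → ∀ st, ‖S st k‖ ≤ levelBound p β k
        ((β * (⌊p⌋₊).factorial * (⌊p⌋₊ : ℝ) ^ 2) ^ p * pathControl hT p X st.1.1 st.1.2) := by
  have hp₀ : 0 < p := by linarith
  have hβ₀ : 0 < β := by linarith
  set L := (β * (⌊p⌋₊).factorial * (⌊p⌋₊ : ℝ) ^ 2) ^ p with hL
  have hc := hX.2.isControl_pathControl hT
  have hω : IsControl fun s t => L * pathControl hT p X s t := hc.const_mul (by positivity)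
  have hr : ∀ s t, s ≤ t →
      L * pathControl hT p X (retract hT s t).1.1 (retract hT s t).1.2 =
        L * pathControl hT p X s t := fun s t _ => by
    rw [pathControl, pathControl, retract_self]
  have hXd : HasFactorialDecay p β (fun s t => L * pathControl hT p X s t) ⌊p⌋₊ X := by
    refine ⟨hX.1, fun k hk hkp st => ?_⟩
    refine le_trans ?_ (rpow_le_levelBound hp₀ hβ hk hkp hp (hc.nonneg st.2.2.1))
    have := hX.2.norm_le_pathControl hT hp₀ hk hkp st.1.1 st.1.2
    rwa [retract_self] at this
  obtain ⟨S, hm, hSX, hS⟩ := hXd.exists_full_extension hT hp hβ hβK hω hr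
  refine ⟨S, ⟨hSX, hm, fun k hk _ st => ?_⟩, hS⟩
  refine levelVariation_ne_top_of_bound hT hp₀ hω hk
    (levelBound_nonneg (p := p) hβ₀.le k zero_le_one)
    (fun s t hst => ?_) st
  rw [← levelBound_eq k (hω.nonneg hst), ← hr s t hst]
  exact hS k hk _

/-- Each norm is at most the total sum, so the sum of squares is at most the square of the sum. -/
theorem lp_two_norm_le_tsum {E : ℕ → Type*} [∀ n, NormedAddCommGroup (E n)] {f : ∀ n, E n}
    (hf : Summable fun n => ‖f n‖) :
    ∃ x : lp E 2, (∀ n, x n = f n) ∧ ‖x‖ ≤ ∑' n, ‖f n‖ := by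
  have hle : ∀ n, ‖f n‖ ^ 2 ≤ (∑' n, ‖f n‖) * ‖f n‖ := fun n => by
    rw [sq]
    exact mul_le_mul_of_nonneg_right (hf.le_tsum n fun _ _ => norm_nonneg _) (norm_nonneg _)
  have hsq : Summable fun n => ‖f n‖ ^ 2 :=
    Summable.of_nonneg_of_le (fun n => by positivity) hle (hf.mul_left _)
  have hmem : Memℓp f 2 := memℓp_gen (by simpa using hsq)
  refine ⟨⟨f, hmem⟩, fun _ => rfl, ?_⟩
  refine lp.norm_le_of_tsum_le (by norm_num) (tsum_nonneg fun _ => norm_nonneg _) ?_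
  have := (hsq.tsum_le_tsum hle (hf.mul_left _)).trans_eq tsum_mul_left
  simpa [sq] using this

end Existence

/-! ### The constants and the final bound. -/

theorem corollary2p7 (p : ℝ) (hp : 1 ≤ p) :
    ∃ b C : ℝ, 0 < b ∧ 0 < C ∧
      ∀ (𝕜 : Type v) [RCLike 𝕜] (H : Type u) [NormedAddCommGroup H] [InnerProductSpace 𝕜 H]
        [CompleteSpace H] (T : ℝ), 0 ≤ T →
        ∀ X : Triangle T → ExtTensorAlgebra 𝕜 H, IsRoughPath p X →
          (∃! S : Triangle T → ExtTensorAlgebra 𝕜 H, IsSignature p X S) ∧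
          ∀ S : Triangle T → ExtTensorAlgebra 𝕜 H, IsSignature p X S →
            ∀ st : Triangle T, ∃ x : FockSpace 𝕜 H,
              (∀ n, x n = S st n) ∧
              Summable (fun n => ‖S st n‖) ∧
              ‖x‖ ≤ ∑' n, ‖S st n‖ ∧
              ∑' n, ‖S st n‖ ≤ mittagLeffler (1 / p) 0 (C * variationNorm p X st) / b := by
  have hp₀ : 0 < p := by linarith
  have hq : (0 : ℝ) < ⌊p⌋₊ := by exact_mod_cast Nat.floor_pos.2 hp
  -- The second entry closes the extension step; `β ≥ 1` allows dropping `β n²` from the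
  -- denominators, so that `b = 1` works.
  set β := max 1 (8 * sewingConst ((⌊p⌋₊ + 1) / p))
  have hβ : 1 ≤ β := le_max_left _ _
  have hβK : 8 * sewingConst ((⌊p⌋₊ + 1) / p) ≤ β := le_max_right _ _
  set L := (β * (⌊p⌋₊).factorial * (⌊p⌋₊ : ℝ) ^ 2) ^ p with hL
  have hL₀ : 0 < L := by positivity
  -- `L` rescales the control, and `⌊p⌋₊` is the price of bounding a sum over levels by their
  -- maximum; both depend only on `p`.
  refine ⟨1, (L * ⌊p⌋₊) ^ (1 / p), one_pos, by positivity, ?_⟩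
  intro 𝕜 _ H _ _ _ T hT X hX
  obtain ⟨S, hS, hbound⟩ := hX.exists_signature hT hp hβ hβK
  refine ⟨⟨S, hS, fun S' hS' => hS'.unique hT hp hS⟩, fun S' hS' st => ?_⟩
  obtain rfl := hS'.unique hT hp hS
  set z := (L * ⌊p⌋₊) ^ (1 / p) * variationNorm p X st with hz
  have hV := variationNorm_nonneg p X st
  have hz₀ : 0 ≤ z := by positivity
  have hc₀ := (hX.2.isControl_pathControl hT).nonneg st.2.2.1
  have hω : (L * pathControl hT p X st.1.1 st.1.2) ^ (1 / p) ≤ z := by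
    have h := mul_le_mul_of_nonneg_left (hX.2.pathControl_le hT hp₀ st) hL₀.le
    refine (Real.rpow_le_rpow (by positivity) h (by positivity)).trans_eq ?_
    rw [← mul_assoc, Real.mul_rpow (by positivity) (by positivity), ← Real.rpow_mul hV,
      mul_one_div_cancel hp₀.ne', Real.rpow_one]
  have hterm : ∀ n, ‖S' st n‖ ≤ z ^ n / Real.Gamma (1 / p * n + 0 + 1) := by
    intro n
    rcases Nat.eq_zero_or_pos n with rfl | hn
    · rw [hS'.multiplicative.zero, HilbertTensorPower.norm_one]
      simp
    · have hG : 0 < Real.Gamma (1 / p * n + 1) := Real.Gamma_pos_of_pos (by positivity)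
      rw [add_zero]
      refine (hbound n hn st).trans ((levelBound_le_div_Gamma hp hβ hn (by positivity)).trans ?_)
      gcongr
  have hsummable := summable_mittagLeffler hp hz₀
  have hnorm : Summable fun n => ‖S' st n‖ :=
    Summable.of_nonneg_of_le (fun _ => norm_nonneg _) hterm hsummable
  obtain ⟨x, hx, hxn⟩ := lp_two_norm_le_tsum hnorm
  refine ⟨x, hx, hnorm, hxn, ?_⟩
  rw [div_one]
  exact hnorm.tsum_le_tsum hterm hsummable
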